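/- Let $\Omega\subset\mathbb{R}^d$, $d\ge 1$, be a bounded open set, let $T>0$, $f\in L^2(0,T;H^{-1}(\Omega))$ and $u_0\in H^1_0(\Omega)$. Let $u\in Y:=L^2(0,T;H^1_0(\Omega))\cap H^1(0,T;H^{-1}(\Omega))$ be the weak solution of the heat equation, i.e. $$\langle \partial_t u(t),v\rangle+(\nabla u(t),\nabla v)_\Omega=\langle f(t),v\rangle\quad\forall v\in H^1_0(\Omega),\ \text{for a.e. }t\in(0,T),\qquad u(0)=u_0,$$ where point values in time of $u$ are those of its representative in $C([0,T];L^2(\Omega))$. Let $0=t_0<t_1<\dots<t_N=T$, $N\ge1$, $\tau_n:=t_n-t_{n-1}$, let $f_1,\dots,f_N\in H^{-1}(\Omega)$, and let $u_1,\dots,u_N\in H^1_0(\Omega)$ be the implicit Euler approximations, $$\Big(\frac{u_n-u_{n-1}}{\tau_n},v\Big)_\Omega+(\nabla u_n,\nabla v)_\Omega=\langle f_n,v\rangle\quad\forall v\in H^1_0(\Omega),\ n=1,\dots,N.$$ Let $f_\tau:=f_n$ on $(t_{n-1},t_n)$. Let $u_\tau:[0,T]\to H^1_0(\Omega)$ be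 the left-continuous piecewise constant function with $u_\tau=u_n$ on $(t_{n-1},t_n]$ and $u_\tau(0)=u_0$, let $U_\tau:[0,T]\to H^1_0(\Omega)$ be the continuous function that is affine on each $[t_{n-1},t_n]$ with $U_\tau(t_n)=u_n$ for $n=0,\dots,N$, and let $\overline u_\tau:=\tfrac12(u_\tau+U_\tau)$. Define $$\|v\|_E^2:=\tfrac12\|v(T)\|_\Omega^2+\int_0^T\|\nabla v\|_\Omega^2\,dt,\qquad \eta_J:=\Big(\int_0^T\|\nabla(u_\tau-U_\tau)\|_\Omega^2\,dt\Big)^{1/2}.$$ If there is no data oscillation, i.e. $f=f_\tau$ a.e. in $(0,T)$, then $$\|u-u_\tau\|_E^2+\|u-U_\tau\|_E^2=\|u_\tau-U_\tau\|_E^2=\eta_J^2$$ and $$\|u-\overline u_\tau\|_E=\tfrac12\|u_\tau-U_\tau\|_E=\tfrac12\eta_J .$$ Moreover $\|u_\tau-\overline u_\tau\|_E=\|U_\tau-\overline u_\tau\|_E=\tfrac12\eta_J$, so that $u$, $u_\tau$ and $U_\tau$ all lie on the hypercircle of radius $\tfrac12\eta_J$ centred at $\overline u_\tau$. -/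

import Mathlib

open MeasureTheory Set Filter
open scoped ContDiff

namespace Heat

noncomputable section

/-- `ℝ^d` with the Euclidean norm. -/
abbrev Space (d : ℕ) : Type := EuclideanSpace ℝ (Fin d)

/-- `C_0^∞(D)`: smooth real functions with compact support contained in the open set `D`. -/
structure IsTest {E : Type*} [NormedAddCommGroup E] [NormedSpace ℝ E]
    (D : Set E) (φ : E → ℝ) : Prop where
  smooth : ContDiff ℝ ∞ φ
  compact : HasCompactSupport φ
  subset : tsupport φ ⊆ D

variable {d : ℕ}

/-- `L²(Ω)`. -/
abbrev L2 (Ω : Set (Space d)) : Type := Lp ℝ 2 (volume.restrict Ω)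

/-- `L²(Ω; ℝ^d)`. -/
abbrev L2Vec (Ω : Set (Space d)) : Type := Lp (Space d) 2 (volume.restrict Ω)

/-- `g` is the weak gradient of `v` on `Ω`. -/
def HasWeakGrad (Ω : Set (Space d)) (v : L2 Ω) (g : L2Vec Ω) : Prop :=
  ∀ φ : Space d → ℝ, IsTest Ω φ → ∀ i : Fin d,
    ∫ x in Ω, v x * fderiv ℝ φ x (EuclideanSpace.single i 1) = -∫ x in Ω, g x i * φ x

theorem integrable_mul_of_test {Ω : Set (Space d)} {ψ : Space d → ℝ} (hψ : Continuous ψ)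
    (hc : HasCompactSupport ψ) {v : Space d → ℝ} (hv : MemLp v 2 (volume.restrict Ω)) :
    Integrable (fun x => v x * ψ x) (volume.restrict Ω) :=
  hv.integrable_mul (q := 2) ((hψ.memLp_of_hasCompactSupport hc).restrict Ω)

theorem memLp_coord {Ω : Set (Space d)} (g : L2Vec Ω) (i : Fin d) :
    MemLp (fun x => g x i) 2 (volume.restrict Ω) :=
  (EuclideanSpace.proj (𝕜 := ℝ) i).comp_memLp' (Lp.memLp g)

theorem IsTest.integrable_fderiv {Ω : Set (Space d)} {φ : Space d → ℝ} (hφ : IsTest Ω φ)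
    (v : L2 Ω) (e : Space d) :
    Integrable (fun x => v x * fderiv ℝ φ x e) (volume.restrict Ω) :=
  integrable_mul_of_test ((hφ.smooth.continuous_fderiv (by simp)).clm_apply continuous_const)
    (hφ.compact.fderiv_apply ℝ e) (Lp.memLp v)

theorem IsTest.integrable_coord {Ω : Set (Space d)} {φ : Space d → ℝ} (hφ : IsTest Ω φ)
    (g : L2Vec Ω) (i : Fin d) :
    Integrable (fun x => g x i * φ x) (volume.restrict Ω) :=
  integrable_mul_of_test hφ.smooth.continuous hφ.compact (memLp_coord g i)

theorem HasWeakGrad.add {Ω : Set (Space d)} {v w : L2 Ω} {g h : L2Vec Ω}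
    (hv : HasWeakGrad Ω v g) (hw : HasWeakGrad Ω w h) : HasWeakGrad Ω (v + w) (g + h) := by
  intro φ hφ i
  have e1 : ∫ x in Ω, (v + w) x * fderiv ℝ φ x (EuclideanSpace.single i 1)
      = ∫ x in Ω, (v x * fderiv ℝ φ x (EuclideanSpace.single i 1)
        + w x * fderiv ℝ φ x (EuclideanSpace.single i 1)) := by
    apply integral_congr_ae
    filter_upwards [Lp.coeFn_add v w] with x hx
    rw [hx, Pi.add_apply, add_mul]
  have e2 : ∫ x in Ω, (g + h) x i * φ x = ∫ x in Ω, (g x i * φ x + h x i * φ x) := by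
    apply integral_congr_ae
    filter_upwards [Lp.coeFn_add g h] with x hx
    rw [hx, Pi.add_apply, PiLp.add_apply, add_mul]
  rw [e1, e2, integral_add (hφ.integrable_fderiv v _) (hφ.integrable_fderiv w _),
    integral_add (hφ.integrable_coord g i) (hφ.integrable_coord h i), hv φ hφ i, hw φ hφ i]
  ring

theorem HasWeakGrad.smul {Ω : Set (Space d)} {v : L2 Ω} {g : L2Vec Ω} (c : ℝ)
    (hv : HasWeakGrad Ω v g) : HasWeakGrad Ω (c • v) (c • g) := by
  intro φ hφ i
  have e1 : ∫ x in Ω, (c • v) x * fderiv ℝ φ x (EuclideanSpace.single i 1)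
      = ∫ x in Ω, c * (v x * fderiv ℝ φ x (EuclideanSpace.single i 1)) := by
    apply integral_congr_ae
    filter_upwards [Lp.coeFn_smul c v] with x hx
    rw [hx, Pi.smul_apply, smul_eq_mul, mul_assoc]
  have e2 : ∫ x in Ω, (c • g) x i * φ x = ∫ x in Ω, c * (g x i * φ x) := by
    apply integral_congr_ae
    filter_upwards [Lp.coeFn_smul c g] with x hx
    rw [hx, Pi.smul_apply, PiLp.smul_apply, smul_eq_mul, mul_assoc]
  rw [e1, e2, integral_const_mul, integral_const_mul, hv φ hφ i]
  ring

theorem HasWeakGrad.zero {Ω : Set (Space d)} : HasWeakGrad Ω (0 : L2 Ω) (0 : L2Vec Ω) := by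
  intro φ hφ i
  have e1 : ∫ x in Ω, (0 : L2 Ω) x * fderiv ℝ φ x (EuclideanSpace.single i 1) = 0 := by
    rw [← integral_zero (Space d) ℝ (μ := volume.restrict Ω)]
    apply integral_congr_ae
    filter_upwards [Lp.coeFn_zero ℝ 2 (volume.restrict Ω)] with x hx
    rw [hx, Pi.zero_apply, zero_mul]
  have e2 : ∫ x in Ω, (0 : L2Vec Ω) x i * φ x = 0 := by
    rw [← integral_zero (Space d) ℝ (μ := volume.restrict Ω)]
    apply integral_congr_ae
    filter_upwards [Lp.coeFn_zero (Space d) 2 (volume.restrict Ω)] with x hx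
    rw [hx, Pi.zero_apply, PiLp.zero_apply, zero_mul]
  rw [e1, e2, neg_zero]

/-- `H¹(Ω)`, as the space of pairs `(v, ∇v)` with `v ∈ L²(Ω)` and weak gradient
`∇v ∈ L²(Ω; ℝ^d)`; the norm is `‖v‖² + ‖∇v‖²` under a square root. -/
def H1 (Ω : Set (Space d)) : Submodule ℝ (WithLp 2 (L2 Ω × L2Vec Ω)) where
  carrier := {p | HasWeakGrad Ω p.fst p.snd}
  add_mem' hp hq := HasWeakGrad.add hp hq
  zero_mem' := HasWeakGrad.zero
  smul_mem' c _ hp := HasWeakGrad.smul c hp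

/-- The elements of `H¹(Ω)` that are represented by a function in `C_0^∞(Ω)`. -/
def testSubspace (Ω : Set (Space d)) : Submodule ℝ (H1 Ω) where
  carrier := {v | ∃ φ : Space d → ℝ, IsTest Ω φ ∧
    (v : WithLp 2 (L2 Ω × L2Vec Ω)).fst =ᵐ[volume.restrict Ω] φ}
  add_mem' := by
    rintro v w ⟨φ, hφ, hv⟩ ⟨ψ, hψ, hw⟩
    refine ⟨φ + ψ, ⟨hφ.smooth.add hψ.smooth, hφ.compact.add hψ.compact,
      (tsupport_add φ ψ).trans (union_subset hφ.subset hψ.subset)⟩, ?_⟩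
    exact (Lp.coeFn_add _ _).trans (hv.add hw)
  zero_mem' := by
    refine ⟨0, ⟨contDiff_const, HasCompactSupport.zero, ?_⟩, Lp.coeFn_zero _ _ _⟩
    simp [tsupport]
  smul_mem' := by
    rintro c v ⟨φ, hφ, hv⟩
    refine ⟨c • φ, ⟨hφ.smooth.const_smul c, hφ.compact.smul_left (f := fun _ => c),
      (tsupport_smul_subset_right (fun _ => c) φ).trans hφ.subset⟩, ?_⟩
    exact (Lp.coeFn_smul c _).trans (hv.const_smul c)

/-- `H¹₀(Ω)`: the closure of `C_0^∞(Ω)` in `H¹(Ω)`. -/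
def H10 (Ω : Set (Space d)) : Submodule ℝ (H1 Ω) := (testSubspace Ω).topologicalClosure

/-- The inclusion `H¹₀(Ω) → L²(Ω)`. -/
def toL2 (Ω : Set (Space d)) : H10 Ω →L[ℝ] L2 Ω :=
  (ContinuousLinearMap.fst ℝ (L2 Ω) (L2Vec Ω)).comp
    ((WithLp.prodContinuousLinearEquiv 2 ℝ (L2 Ω) (L2Vec Ω)).toContinuousLinearMap.comp
      ((H1 Ω).subtypeL.comp (H10 Ω).subtypeL))

/-- The weak gradient `∇ : H¹₀(Ω) → L²(Ω; ℝ^d)`. -/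
def grad (Ω : Set (Space d)) : H10 Ω →L[ℝ] L2Vec Ω :=
  (ContinuousLinearMap.snd ℝ (L2 Ω) (L2Vec Ω)).comp
    ((WithLp.prodContinuousLinearEquiv 2 ℝ (L2 Ω) (L2Vec Ω)).toContinuousLinearMap.comp
      ((H1 Ω).subtypeL.comp (H10 Ω).subtypeL))

/-- `H⁻¹(Ω)`, the dual of `H¹₀(Ω)`. For bounded `Ω` its norm is equivalent to the dual norm taken
with respect to `‖∇v‖`, so that both give the same space `L²(0,T;H⁻¹(Ω))`. -/
abbrev HNeg (Ω : Set (Space d)) : Type := StrongDual ℝ (H10 Ω)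

/-- The canonical embedding `L²(Ω) → H⁻¹(Ω)`, `⟨w, v⟩ = (w, v)_Ω`. -/
def toHNeg (Ω : Set (Space d)) (w : L2 Ω) : HNeg Ω := (innerSL ℝ w).comp (toL2 Ω)

/-- `v ∈ L²(0,T;V)`. -/
def MemBochner {V : Type*} [NormedAddCommGroup V] (T : ℝ) (v : ℝ → V) : Prop :=
  MemLp v 2 (volume.restrict (Ioo 0 T))

/-- `w` is the weak time derivative of `v` on `(0,T)`. -/
def HasWeakTimeDeriv {V : Type*} [NormedAddCommGroup V] [NormedSpace ℝ V]
    (T : ℝ) (v w : ℝ → V) : Prop :=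
  ∀ φ : ℝ → ℝ, IsTest (Ioo 0 T) φ →
    ∫ t in Ioo 0 T, deriv φ t • v t = -∫ t in Ioo 0 T, φ t • w t

/-- The function `du` is the weak time derivative of `u ∈ Y = L²(0,T;H¹₀(Ω)) ∩ H¹(0,T;H⁻¹(Ω))`. -/
structure HasYDeriv {Ω : Set (Space d)} (T : ℝ) (u : ℝ → H10 Ω) (du : ℝ → HNeg Ω) : Prop where
  memX : MemBochner T u
  memDeriv : MemBochner T du
  weakDeriv : HasWeakTimeDeriv T (fun t => toHNeg Ω (toL2 Ω (u t))) du

/-- `w` is a representative of `u` in `C([0,T];L²(Ω))`. -/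
def IsContRep {Ω : Set (Space d)} (T : ℝ) (u : ℝ → H10 Ω) (w : ℝ → L2 Ω) : Prop :=
  ContinuousOn w (Icc 0 T) ∧ ∀ᵐ t ∂volume.restrict (Ioo 0 T), w t = toL2 Ω (u t)

open Classical in
/-- The value `u(s) ∈ L²(Ω)`, `s ∈ [0,T]`, of an a.e. defined `u ∈ Y`, read off its (unique)
representative in `C([0,T];L²(Ω))`. -/
def timeValue {Ω : Set (Space d)} (T : ℝ) (u : ℝ → H10 Ω) (s : ℝ) : L2 Ω :=
  if h : ∃ w, IsContRep T u w then Classical.choose h s else 0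

/-- `u ∈ Y` is a weak solution of the heat equation with source `f` and initial value `u₀`. -/
structure IsWeakSolution {Ω : Set (Space d)} (T : ℝ) (f : ℝ → HNeg Ω) (u₀ : L2 Ω)
    (u : ℝ → H10 Ω) : Prop where
  equation : ∃ du : ℝ → HNeg Ω, HasYDeriv T u du ∧
    ∀ᵐ t ∂volume.restrict (Ioo 0 T), ∀ v : H10 Ω,
      du t v + inner ℝ (grad Ω (u t)) (grad Ω v) = f t v
  initial : timeValue T u 0 = u₀

/-- Time-step points `0 = t_0 < t_1 < ⋯ < t_N = T` with `N ≥ 1`; values of `pt` beyond `N` are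
irrelevant. -/
structure TimeGrid (T : ℝ) where
  N : ℕ
  one_le : 1 ≤ N
  pt : ℕ → ℝ
  pt_zero : pt 0 = 0
  pt_last : pt N = T
  pt_lt : ∀ n < N, pt n < pt (n + 1)

/-- The time-step length `τ_{n+1} = t_{n+1} - t_n`. -/
def TimeGrid.step {T : ℝ} (G : TimeGrid T) (n : ℕ) : ℝ := G.pt (n + 1) - G.pt n

/-- The left-continuous function on `[0,T]` equal to `x_n` on `(t_{n-1}, t_n]`, `n = 1, …, N`, and
to `x_0` at `0`. -/
def pwConst {V : Type*} [AddCommGroup V] {T : ℝ} (G : TimeGrid T) (x : ℕ → V) (t : ℝ) : V :=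
  if t ≤ 0 then x 0
  else ∑ n ∈ Finset.range G.N, (Ioc (G.pt n) (G.pt (n + 1))).indicator (fun _ => x (n + 1)) t

/-- The continuous piecewise affine function on `[0,T]` equal to `x_n` at `t_n`, `n = 0, …, N`. -/
def pwAffine {V : Type*} [AddCommGroup V] [Module ℝ V] {T : ℝ} (G : TimeGrid T) (x : ℕ → V)
    (t : ℝ) : V :=
  if t ≤ 0 then x 0
  else ∑ n ∈ Finset.range G.N, (Ioc (G.pt n) (G.pt (n + 1))).indicator
    (fun s => ((s - G.pt n) / G.step n) • x (n + 1) + ((G.pt (n + 1) - s) / G.step n) • x n) t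

/-- `(U n)` is the sequence of implicit Euler approximations with initial value `u₀` and source
values `F 1, …, F N`. -/
def IsImplicitEuler {Ω : Set (Space d)} {T : ℝ} (G : TimeGrid T) (F : ℕ → HNeg Ω) (u₀ : H10 Ω)
    (U : ℕ → H10 Ω) : Prop :=
  U 0 = u₀ ∧ ∀ n < G.N, ∀ v : H10 Ω,
    inner ℝ ((G.step n)⁻¹ • (toL2 Ω (U (n + 1)) - toL2 Ω (U n))) (toL2 Ω v)
      + inner ℝ (grad Ω (U (n + 1))) (grad Ω v) = F (n + 1) v

/-- `‖v‖_X = (∫_0^T ‖∇v‖²_Ω dt)^{1/2}`. -/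
def normX {Ω : Set (Space d)} (T : ℝ) (v : ℝ → H10 Ω) : ℝ :=
  √(∫ t in Ioo 0 T, ‖grad Ω (v t)‖ ^ 2)

/-- The energy norm `‖v‖_E = (½‖v(T)‖²_Ω + ∫_0^T ‖∇v‖²_Ω dt)^{1/2}`, for a function on `(0,T)`
given together with its value at the final time, as a pair `(v, v(T))`. -/
def normE {Ω : Set (Space d)} (T : ℝ) (v : (ℝ → H10 Ω) × L2 Ω) : ℝ :=
  √(1 / 2 * ‖v.2‖ ^ 2 + ∫ t in Ioo 0 T, ‖grad Ω (v.1 t)‖ ^ 2)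

/-- The pair `(u, u(T))` for `u ∈ Y`. -/
def withFinalY {Ω : Set (Space d)} (T : ℝ) (u : ℝ → H10 Ω) : (ℝ → H10 Ω) × L2 Ω :=
  (u, timeValue T u T)

/-- The pair `(v, v(T))` for a function `v` defined at every point of `[0,T]`. -/
def withFinal {Ω : Set (Space d)} (T : ℝ) (v : ℝ → H10 Ω) : (ℝ → H10 Ω) × L2 Ω :=
  (v, toL2 Ω (v T))

/-- The temporal jump estimator `η_J = ‖u_τ - U_τ‖_X`. -/
def etaJ {Ω : Set (Space d)} {T : ℝ} (G : TimeGrid T) (U : ℕ → H10 Ω) : ℝ :=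
  normX T (pwConst G U - pwAffine G U)

end

end Heat

/-! Put `e = u - U_τ`. On each time interval `U_τ` has derivative `(u_n - u_{n-1})/τ_n`, so when `f
= f_τ` subtracting the scheme from the equation gives `⟨∂_t e, v⟩ = -(∇(u - u_τ), ∇v)`. Test with `v
= e`. Since `u_τ - U_τ = (u - U_τ) - (u - u_τ)`, expanding the square turns `-2(∇(u - u_τ), ∇(u -
U_τ))` into `‖∇(u_τ - U_τ)‖² - ‖∇(u - u_τ)‖² - ‖∇(u - U_τ)‖²` (`two_mul_residual_apply`). Integrate
in time: `e(0) = 0`, and because `u_τ(T) = U_τ(T)` the term `‖e(T)‖²` is shared equally between the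
two energy norms. This is the Pythagorean identity `energyNorm_sq_add_energyNorm_sq`. The
hypercircle statement is then Thales' theorem in a space obeying the parallelogram law
(`energyNorm_hypercircle`).

The analytic core is `‖e(T)‖² - ‖e(0)‖² = 2∫⟨∂_t e, e⟩` for `e ∈ Y`, together with the existence of
a continuous representative. The weak derivative is first integrated: as an element of `V'`, `e(t)`
is a.e. a constant plus the primitive of `∂_t e`. The energy identity between almost all pairs of
times follows from Steklov difference quotients, `‖x‖² - ‖y‖² = (x - y, x + y)`, and continuity of
translations in `L²` (`norm_sq_sub_norm_sq_eq`). That identity yields a Cauchy estimate in `H`,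
hence the representative (`exists_continuousOn_ae_eq`), and by continuity it extends to the
endpoints. All this is done for a bounded map `i : V → H`; neither density nor injectivity of `i` is
used. -/

namespace Heat

/-! ### Vector-valued weak derivatives on an interval. -/

section WeakDerivative

variable {X : Type*} [NormedAddCommGroup X] [NormedSpace ℝ X]

theorem exists_isTest_integral_eq_one {T : ℝ} (hT : 0 < T) :
    ∃ h : ℝ → ℝ, IsTest (Ioo 0 T) h ∧ ∫ t, h t = 1 := by
  let b : ContDiffBump (T / 2) := ⟨T / 8, T / 4, by positivity, by linarith⟩
  refine ⟨b.normed volume, ⟨b.contDiff_normed, b.hasCompactSupport_normed, ?_⟩, b.integral_normed⟩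
  rw [b.tsupport_normed_eq]
  intro x hx
  rw [Real.closedBall_eq_Icc] at hx
  have h1 : b.rOut = T / 4 := rfl
  rw [h1] at hx
  exact ⟨by linarith [hx.1], by linarith [hx.2]⟩

/-- A test function with vanishing integral has a test function as primitive. -/
theorem IsTest.exists_primitive {T : ℝ} {h : ℝ → ℝ} (hh : IsTest (Ioo 0 T) h)
    (h0 : ∫ t, h t = 0) : ∃ φ : ℝ → ℝ, IsTest (Ioo 0 T) φ ∧ deriv φ = h := by
  rcases (tsupport h).eq_empty_or_nonempty with he | hne
  · have hz : h = 0 := tsupport_eq_empty_iff.mp he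
    exact ⟨0, hz ▸ hh, by rw [hz]; ext x; simp⟩
  obtain ⟨a, ha⟩ := hh.compact.exists_isLeast hne
  obtain ⟨b, hb⟩ := hh.compact.exists_isGreatest hne
  have hsub : tsupport h ⊆ Icc a b := fun x hx => ⟨ha.2 hx, hb.2 hx⟩
  have hcont : Continuous h := hh.smooth.continuous
  have hder : ∀ x, HasDerivAt (fun x => ∫ t in (0 : ℝ)..x, h t) (h x) x := fun x =>
    intervalIntegral.integral_hasDerivAt_right (hcont.intervalIntegrable _ _)
      (hcont.stronglyMeasurableAtFilter _ _) hcont.continuousAt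
  have hd : deriv (fun x => ∫ t in (0 : ℝ)..x, h t) = h := funext fun x => (hder x).deriv
  have ha0 : 0 < a := (hh.subset ha.1).1
  have hzero : ∀ x, x ∉ Icc a b → h x = 0 := fun x hx =>
    image_eq_zero_of_notMem_tsupport fun hx' => hx (hsub hx')
  -- To the left of the support the integrand vanishes; to the right of it the primitive has reached
  -- the total integral, which is zero.
  have hsupp : ∀ x, x ∉ Icc a b → ∫ t in (0 : ℝ)..x, h t = 0 := by
    intro x hx
    rcases lt_or_ge x a with hxa | hxa
    · apply intervalIntegral.integral_zero_ae
      refine Eventually.of_forall fun t ht => hzero t fun ht' => ?_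
      rcases (mem_uIoc.mp ht) with h' | h'
      · linarith [h'.2, ht'.1]
      · linarith [h'.2, ht'.1]
    · have hxb : b < x := by
        by_contra hxb
        exact hx ⟨hxa, not_lt.mp hxb⟩
      rw [intervalIntegral.integral_of_le (by linarith), ← h0]
      apply setIntegral_eq_integral_of_forall_compl_eq_zero
      intro t ht
      apply hzero
      intro ht'
      exact ht ⟨by linarith [ht'.1], by linarith [ht'.2]⟩
  have hts : tsupport (fun x => ∫ t in (0 : ℝ)..x, h t) ⊆ Icc a b :=
    closure_minimal (fun x hx => by_contra fun hx' => hx (hsupp x hx')) isClosed_Icc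
  refine ⟨fun x => ∫ t in (0 : ℝ)..x, h t, ⟨?_, ?_, ?_⟩, hd⟩
  · rw [contDiff_infty_iff_deriv, hd]
    exact ⟨fun x => (hder x).differentiableAt, hh.smooth⟩
  · exact HasCompactSupport.of_support_subset_isCompact isCompact_Icc (subset_closure.trans hts)
  · exact hts.trans fun x hx =>
      ⟨lt_of_lt_of_le ha0 hx.1, lt_of_le_of_lt hx.2 (hh.subset hb.1).2⟩

theorem integrableOn_smul_of_hasCompactSupport {T : ℝ} {φ : ℝ → ℝ} (hφ : Continuous φ)
    (hc : HasCompactSupport φ)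
    {w : ℝ → X} (hw : IntegrableOn w (Ioo 0 T)) :
    IntegrableOn (fun t => φ t • w t) (Ioo 0 T) := by
  obtain ⟨C, hC⟩ := hφ.bounded_above_of_compact_support hc
  exact Integrable.bdd_smul hw C hφ.aestronglyMeasurable (Eventually.of_forall hC)

/-- The du Bois-Reymond argument. With a fixed test function `k` of integral one, `g - (∫ g) k` has
mean zero for every test function `g`, hence is the derivative of a test function. The hypothesis
then reads `∫ g f = (∫ g) c` with `c = ∫ k f`, so `f - c` is orthogonal to all test functions. -/
theorem ae_eq_const_of_integral_deriv_smul_eq_zero [CompleteSpace X] {T : ℝ} (hT : 0 < T)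
    {f : ℝ → X} (hf : IntegrableOn f (Ioo 0 T))
    (h : ∀ φ : ℝ → ℝ, IsTest (Ioo 0 T) φ → ∫ t in Ioo 0 T, deriv φ t • f t = 0) :
    ∃ c : X, ∀ᵐ t ∂volume.restrict (Ioo 0 T), f t = c := by
  obtain ⟨k, hk, hk1⟩ := exists_isTest_integral_eq_one hT
  refine ⟨∫ t in Ioo 0 T, k t • f t, ?_⟩
  set c := ∫ t in Ioo 0 T, k t • f t with hc
  have hint : IntegrableOn (fun t => f t - c) (Ioo 0 T) :=
    hf.sub (integrableOn_const (by simp))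
  have key := isOpen_Ioo.ae_eq_zero_of_integral_contDiff_smul_eq_zero (μ := volume)
    hint.locallyIntegrableOn (f := fun t => f t - c) (U := Ioo 0 T) ?_
  · rw [ae_restrict_iff' measurableSet_Ioo]
    filter_upwards [key] with t ht hmem
    exact sub_eq_zero.mp (ht hmem)
  intro g hg hgc hgs
  have hgt : IsTest (Ioo 0 T) g := ⟨hg, hgc, hgs⟩
  have hsupp : ∀ {m : ℝ → ℝ}, IsTest (Ioo 0 T) m → ∀ t, t ∉ Ioo 0 T → m t = 0 := fun hm t ht =>
    image_eq_zero_of_notMem_tsupport fun ht' => ht (hm.subset ht')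
  set s := ∫ t, g t with hs
  have hm : IsTest (Ioo 0 T) (fun t => g t - s * k t) := by
    refine ⟨hg.sub (contDiff_const.mul hk.smooth), hgc.sub hk.compact.mul_left, ?_⟩
    refine (tsupport_sub _ _).trans (union_subset hgs ?_)
    exact (tsupport_mul_subset_right (f := fun _ => s)).trans hk.subset
  have hgi : Integrable g := hg.continuous.integrable_of_hasCompactSupport hgc
  have hki : Integrable k := hk.smooth.continuous.integrable_of_hasCompactSupport hk.compact
  obtain ⟨φ, hφ, hφd⟩ := hm.exists_primitive (by
    rw [integral_sub hgi (hki.const_mul s), integral_const_mul, hk1]; simp [hs])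
  have h0 := h φ hφ
  have hgf := integrableOn_smul_of_hasCompactSupport hg.continuous hgc hf
  have hkf := integrableOn_smul_of_hasCompactSupport hk.smooth.continuous hk.compact hf
  have e1 : ∫ t in Ioo 0 T, deriv φ t • f t = (∫ t in Ioo 0 T, g t • f t) - s • c := by
    rw [hφd, hc, ← integral_smul]
    refine Eq.trans ?_ (integral_sub hgf (hkf.smul s))
    simp only [sub_smul, mul_smul]
  have e2 : ∫ t, g t • (f t - c) = ∫ t in Ioo 0 T, g t • (f t - c) := by
    symm
    apply setIntegral_eq_integral_of_forall_compl_eq_zero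
    intro t ht
    rw [hsupp hgt t ht, zero_smul]
  have e3 : ∫ t in Ioo 0 T, g t = s :=
    setIntegral_eq_integral_of_forall_compl_eq_zero (hsupp hgt)
  rw [e2]
  simp only [smul_sub]
  rw [integral_sub hgf (hgi.integrableOn.smul_const c), integral_smul_const, e3, ← e1, h0]

/-- Fubini for `φ'(t) w(s)` on the triangle `s ≤ t`: integrating in `t` first leaves `φ(T) - φ(s) =
-φ(s)`. -/
theorem integral_deriv_smul_primitive [CompleteSpace X] {T : ℝ} {w : ℝ → X}
    (hw : IntegrableOn w (Ioo 0 T)) {φ : ℝ → ℝ} (hφ : IsTest (Ioo 0 T) φ) :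
    ∫ t in Ioo 0 T, deriv φ t • (∫ s in (0 : ℝ)..t, w s) = -∫ t in Ioo 0 T, φ t • w t := by
  have hdc : Continuous (deriv φ) := hφ.smooth.continuous_deriv (by simp)
  have hdi : IntegrableOn (deriv φ) (Ioo 0 T) :=
    (hdc.integrable_of_hasCompactSupport hφ.compact.deriv).integrableOn
  have hprod : Integrable (fun p : ℝ × ℝ => {q : ℝ × ℝ | q.2 ≤ q.1}.indicator
      (fun p => deriv φ p.1 • w p.2) p)
      ((volume.restrict (Ioo 0 T)).prod (volume.restrict (Ioo 0 T))) :=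
    (hdi.smul_prod hw).indicator (measurableSet_le measurable_snd measurable_fst)
  have hswap := integral_integral_swap (f := fun t s => {q : ℝ × ℝ | q.2 ≤ q.1}.indicator
      (fun p => deriv φ p.1 • w p.2) (t, s)) hprod
  have hφT : φ T = 0 := image_eq_zero_of_notMem_tsupport fun h => lt_irrefl _ (hφ.subset h).2
  have e1 : ∀ t ∈ Ioo 0 T, ∫ s in Ioo 0 T, {q : ℝ × ℝ | q.2 ≤ q.1}.indicator
      (fun p => deriv φ p.1 • w p.2) (t, s) = deriv φ t • ∫ s in (0 : ℝ)..t, w s := by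
    intro t ht
    rw [intervalIntegral.integral_of_le ht.1.le, ← integral_smul]
    have : (fun s => {q : ℝ × ℝ | q.2 ≤ q.1}.indicator (fun p => deriv φ p.1 • w p.2) (t, s))
        = (Iic t).indicator (fun s => deriv φ t • w s) := by
      ext s; simp [indicator]
    rw [this, setIntegral_indicator measurableSet_Iic]
    congr 2
    ext s
    constructor
    · rintro ⟨h1, h2⟩; exact ⟨h1.1, h2⟩
    · rintro ⟨h1, h2⟩; exact ⟨⟨h1, lt_of_le_of_lt h2 ht.2⟩, h2⟩
  have e2 : ∀ s ∈ Ioo 0 T, ∫ t in Ioo 0 T, {q : ℝ × ℝ | q.2 ≤ q.1}.indicator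
      (fun p => deriv φ p.1 • w p.2) (t, s) = -(φ s • w s) := by
    intro s hs
    have : (fun t => {q : ℝ × ℝ | q.2 ≤ q.1}.indicator (fun p => deriv φ p.1 • w p.2) (t, s))
        = (Ici s).indicator (fun t => deriv φ t • w s) := by
      ext s; simp [indicator]
    rw [this, setIntegral_indicator measurableSet_Ici]
    have hset : Ioo 0 T ∩ Ici s = Ico s T := by
      ext t
      constructor
      · rintro ⟨h1, h2⟩; exact ⟨h2, h1.2⟩
      · rintro ⟨h1, h2⟩; exact ⟨⟨lt_of_lt_of_le hs.1 h1, h2⟩, h1⟩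
    rw [hset, integral_smul_const, integral_Ico_eq_integral_Ioc,
      ← intervalIntegral.integral_of_le hs.2.le,
      intervalIntegral.integral_deriv_eq_sub
        (fun x _ => (hφ.smooth.differentiable (by simp)) x) (hdc.intervalIntegrable _ _), hφT]
    simp
  rw [setIntegral_congr_fun measurableSet_Ioo e1, setIntegral_congr_fun measurableSet_Ioo e2,
    integral_neg] at hswap
  exact hswap

theorem continuousOn_primitive_of_integrableOn {T : ℝ} {w : ℝ → X}
    (hw : IntegrableOn w (Ioo 0 T)) : ContinuousOn (fun t => ∫ s in (0 : ℝ)..t, w s) (Icc 0 T) :=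
  (intervalIntegral.continuousOn_primitive (μ := volume)
    ((integrableOn_Icc_iff_integrableOn_Ioo (by simp) (by simp)).mpr hw)).congr
    fun t ht => by rw [intervalIntegral.integral_of_le ht.1]

/-- A function with an integrable weak derivative is a.e. a primitive of it. -/
theorem HasWeakTimeDeriv.exists_ae_eq_primitive [CompleteSpace X] {T : ℝ} (hT : 0 < T)
    {v w : ℝ → X} (hv : IntegrableOn v (Ioo 0 T)) (hw : IntegrableOn w (Ioo 0 T))
    (h : HasWeakTimeDeriv T v w) :
    ∃ c : X, ∀ᵐ t ∂volume.restrict (Ioo 0 T), v t = c + ∫ s in (0 : ℝ)..t, w s := by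
  have hP : IntegrableOn (fun t => ∫ s in (0 : ℝ)..t, w s) (Ioo 0 T) :=
    ((continuousOn_primitive_of_integrableOn hw).integrableOn_Icc).mono_set Ioo_subset_Icc_self
  obtain ⟨c, hc⟩ := ae_eq_const_of_integral_deriv_smul_eq_zero hT
    (f := fun t => v t - ∫ s in (0 : ℝ)..t, w s) (hv.sub hP) (by
      intro φ hφ
      have hdc : Continuous (deriv φ) := hφ.smooth.continuous_deriv (by simp)
      simp only [smul_sub]
      rw [integral_sub (integrableOn_smul_of_hasCompactSupport hdc hφ.compact.deriv hv)
        (integrableOn_smul_of_hasCompactSupport hdc hφ.compact.deriv hP), h φ hφ,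
        integral_deriv_smul_primitive hw hφ, sub_self])
  exact ⟨c, hc.mono fun t ht => by rw [← ht, sub_add_cancel]⟩

end WeakDerivative

/-! ### The energy identity at almost every time. -/

section Energy

open scoped Topology

variable {V : Type*} [NormedAddCommGroup V] [NormedSpace ℝ V]

theorem integrable_apply_of_memLp {α : Type*} [MeasurableSpace α] {μ : Measure α}
    {g : α → StrongDual ℝ V} {e : α → V} (hg : MemLp g 2 μ) (he : MemLp e 2 μ) :
    Integrable (fun t => g t (e t)) μ :=
  (hg.norm.integrable_mul he.norm).mono'
    (ContinuousLinearMap.aestronglyMeasurable_comp₂ (ContinuousLinearMap.id ℝ _) hg.1 he.1)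
    (Eventually.of_forall fun t => (g t).le_opNorm (e t))

/-- Translation is continuous in `L²`, hence so is the duality pairing of translates. -/
theorem continuous_integral_apply_translate {g : ℝ → StrongDual ℝ V} {e : ℝ → V}
    (hg : MemLp g 2 volume) (he : MemLp e 2 volume) (s : Set ℝ) :
    Continuous fun p : ℝ × ℝ => ∫ t in s, g (t + p.1) (e (t + p.2) + e t) := by
  have : Fact ((2 : ENNReal) ≠ ⊤) := ⟨by simp⟩
  let β := ContinuousLinearMap.lpPairing (volume.restrict s) 2 2
    (ContinuousLinearMap.id ℝ (StrongDual ℝ V))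
  let r₁ := LpToLpRestrictCLM ℝ (StrongDual ℝ V) ℝ volume 2 s
  let r₂ := LpToLpRestrictCLM ℝ V ℝ volume 2 s
  have hc : Continuous fun p : ℝ × ℝ =>
      β (r₁ (DomAddAct.mk p.1 +ᵥ hg.toLp g)) (r₂ ((DomAddAct.mk p.2 +ᵥ he.toLp e) + he.toLp e)) := by
    have c1 : Continuous fun p : ℝ × ℝ => (DomAddAct.mk p.1 +ᵥ hg.toLp g) :=
      (DomAddAct.continuous_mk.comp continuous_fst).vadd continuous_const
    have c2 : Continuous fun p : ℝ × ℝ => (DomAddAct.mk p.2 +ᵥ he.toLp e) :=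
      (DomAddAct.continuous_mk.comp continuous_snd).vadd continuous_const
    exact (β.continuous.comp (r₁.continuous.comp c1)).clm_apply
      (r₂.continuous.comp (c2.add continuous_const))
  convert hc using 2 with p
  rw [ContinuousLinearMap.lpPairing_eq_integral]
  apply integral_congr_ae
  have h1 := LpToLpRestrictCLM_coeFn ℝ s (DomAddAct.mk p.1 +ᵥ hg.toLp g)
  have h2 := LpToLpRestrictCLM_coeFn ℝ s ((DomAddAct.mk p.2 +ᵥ he.toLp e) + he.toLp e)
  have h3 := ae_restrict_of_ae (s := s)
    (Lp.coeFn_add (DomAddAct.mk p.2 +ᵥ he.toLp e) (he.toLp e))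
  rw [DomAddAct.mk_vadd_toLp] at h1 h2 h3
  have h4 := ae_restrict_of_ae (s := s) (MemLp.coeFn_toLp
    (hg.comp_measurePreserving (measurePreserving_vadd p.1 volume)))
  have h5 := ae_restrict_of_ae (s := s) (MemLp.coeFn_toLp
    (he.comp_measurePreserving (measurePreserving_vadd p.2 volume)))
  have h6 := ae_restrict_of_ae (s := s) (MemLp.coeFn_toLp he)
  filter_upwards [h1, h2, h3, h4, h5, h6] with t a1 a2 a3 a4 a5 a6
  simp only [ContinuousLinearMap.coe_id', id_eq]
  erw [a1, a2]
  rw [a3, Pi.add_apply, a6]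
  erw [a4, a5]
  simp [add_comm]

/-- Substituting `σ ↦ t + σ` and applying Fubini expresses the pairing with an increment of the
primitive as an integral over translations, to which continuity in `L²` applies. -/
theorem integral_integral_apply_translate_swap {g : ℝ → StrongDual ℝ V} {k : ℝ → V}
    (hg : MemLp g 2 volume) (hk : MemLp k 2 volume) (s : Set ℝ) {h : ℝ} (hh : 0 ≤ h) :
    ∫ t in s, (∫ σ in t..(t + h), g σ) (k t) =
      ∫ σ in (0 : ℝ)..h, ∫ t in s, g (t + σ) (k t) := by
  -- The shear `(t, σ) ↦ (t + σ, σ)` preserves measure only when `t` ranges over the whole line, so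
  -- measurability and integrability are established there and restricted to `s` afterwards.
  have hmp := measurePreserving_add_prod (volume : Measure ℝ) (volume.restrict (Ioc 0 h))
  have hle : (volume.restrict s).prod (volume.restrict (Ioc 0 h)) ≤
      (volume : Measure ℝ).prod (volume.restrict (Ioc 0 h)) :=
    Measure.prod_mono Measure.restrict_le_self le_rfl
  have hg2 : Integrable (fun t => ‖g t‖ ^ 2) := hg.integrable_norm_pow (by simp)
  have hk2 : Integrable (fun t => ‖k t‖ ^ 2) := hk.integrable_norm_pow (by simp)
  have hone : Integrable (fun _ : ℝ => (1 : ℝ)) (volume.restrict (Ioc 0 h)) :=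
    integrable_const _
  have i1 : Integrable (fun p : ℝ × ℝ => ‖g (p.1 + p.2)‖ ^ 2)
      ((volume.restrict s).prod (volume.restrict (Ioc 0 h))) := by
    have := hmp.integrable_comp_of_integrable (hg2.mul_prod hone)
    simpa [Function.comp_def] using this.mono_measure hle
  have i2 : Integrable (fun p : ℝ × ℝ => ‖k p.1‖ ^ 2)
      ((volume.restrict s).prod (volume.restrict (Ioc 0 h))) := by
    simpa using (hk2.mul_prod hone).mono_measure hle
  have m1 : AEStronglyMeasurable (fun p : ℝ × ℝ => g (p.1 + p.2))
      ((volume.restrict s).prod (volume.restrict (Ioc 0 h))) :=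
    ((hg.1.comp_fst (ν := volume.restrict (Ioc 0 h))).comp_measurePreserving hmp).mono_measure hle
  have m2 : AEStronglyMeasurable (fun p : ℝ × ℝ => k p.1)
      ((volume.restrict s).prod (volume.restrict (Ioc 0 h))) := hk.1.restrict.comp_fst
  have hint : Integrable (fun p : ℝ × ℝ => g (p.1 + p.2) (k p.1))
      ((volume.restrict s).prod (volume.restrict (Ioc 0 h))) := by
    refine (i1.add i2).mono'
      (ContinuousLinearMap.aestronglyMeasurable_comp₂ (ContinuousLinearMap.id ℝ _) m1 m2)
      (Eventually.of_forall fun p => ((g (p.1 + p.2)).le_opNorm (k p.1)).trans ?_)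
    simp only [Pi.add_apply]
    nlinarith [sq_nonneg (‖g (p.1 + p.2)‖ - ‖k p.1‖), sq_nonneg (‖g (p.1 + p.2)‖),
      sq_nonneg (‖k p.1‖)]
  have hloc : LocallyIntegrable g := hg.locallyIntegrable (by norm_num)
  rw [intervalIntegral.integral_of_le hh]
  rw [← integral_integral_swap (f := fun t σ => g (t + σ) (k t)) hint]
  congr 1
  ext t
  rw [ContinuousLinearMap.intervalIntegral_apply (𝕜 := ℝ) (φ := g)
    ((hloc.integrableOn_isCompact isCompact_uIcc).intervalIntegrable) (k t),
    ← intervalIntegral.integral_of_le hh]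
  simpa using (intervalIntegral.integral_comp_add_left (fun σ => g σ (k t)) t
    (a := 0) (b := h)).symm

/-- After the swap the quotient is the mean over `σ ∈ (0, h)` of a function that is jointly
continuous in `(σ, h)`. It tends to the value at the origin, where `e(t + h) + e(t)` has become `2
e(t)`. -/
theorem tendsto_steklov_pairing {g : ℝ → StrongDual ℝ V} {e : ℝ → V}
    (hg : MemLp g 2 volume) (he : MemLp e 2 volume) (s : Set ℝ) :
    Tendsto (fun h : ℝ => h⁻¹ * ∫ t in s, (∫ σ in t..(t + h), g σ) (e (t + h) + e t))
      (𝓝[>] 0) (𝓝 (2 * ∫ t in s, g t (e t))) := by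
  set F : ℝ × ℝ → ℝ := fun p => ∫ t in s, g (t + p.1) (e (t + p.2) + e t) with hF
  have hFc : Continuous F := continuous_integral_apply_translate hg he s
  have hF0 : F (0, 0) = 2 * ∫ t in s, g t (e t) := by
    simp only [hF, add_zero]
    rw [← integral_const_mul]
    congr 1; ext t; rw [map_add]; ring
  rw [← hF0, Metric.tendsto_nhdsWithin_nhds]
  intro ε hε
  obtain ⟨δ, hδ, hd⟩ := Metric.continuousAt_iff.mp (hFc.continuousAt (x := (0, 0))) (ε / 2)
    (by positivity)
  refine ⟨δ, hδ, fun h hh hhd => ?_⟩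
  have hh0 : (0 : ℝ) < h := hh
  have hhd' : h < δ := by simpa [abs_of_pos hh0] using hhd
  have htr : MemLp (fun t => e (t + h)) 2 volume :=
    he.comp_measurePreserving (measurePreserving_add_right volume h)
  rw [integral_integral_apply_translate_swap (k := fun t => e (t + h) + e t) hg (htr.add he) s
    hh0.le]
  have hcont : Continuous fun σ => F (σ, h) := hFc.comp (by fun_prop)
  have hbound : ‖∫ σ in (0 : ℝ)..h, (F (σ, h) - F (0, 0))‖ ≤ ε / 2 * |h - 0| := by
    apply intervalIntegral.norm_integral_le_of_norm_le_const
    intro σ hσ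
    rw [uIoc_of_le hh0.le] at hσ
    refine (hd (x := (σ, h)) ?_).le
    rw [Prod.dist_eq, max_lt_iff]
    constructor
    · simpa [abs_of_pos hσ.1] using lt_of_le_of_lt hσ.2 hhd'
    · simpa [abs_of_pos hh0] using hhd'
  rw [intervalIntegral.integral_sub (hcont.intervalIntegrable _ _)
    (continuous_const.intervalIntegrable _ _), intervalIntegral.integral_const, sub_zero,
    smul_eq_mul, abs_of_pos hh0] at hbound
  have heq : h⁻¹ * (∫ σ in (0 : ℝ)..h, F (σ, h)) - F (0, 0)
      = h⁻¹ * ((∫ σ in (0 : ℝ)..h, F (σ, h)) - h * F (0, 0)) := by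
    field_simp
  have hgoal : |h⁻¹ * (∫ σ in (0 : ℝ)..h, F (σ, h)) - F (0, 0)| < ε := by
    rw [heq, abs_mul, abs_of_pos (inv_pos.mpr hh0)]
    calc h⁻¹ * |(∫ σ in (0 : ℝ)..h, F (σ, h)) - h * F (0, 0)|
        ≤ h⁻¹ * (ε / 2 * h) := by gcongr; exact hbound
      _ = ε / 2 := by field_simp
      _ < ε := by linarith
  exact hgoal

/-- With `Ψ` the primitive of `ψ`, the integral equals `(Ψ(b + h) - Ψ(b)) - (Ψ(a + h) - Ψ(a))`, so
the quotient is a difference of two slopes. The differentiability hypotheses hold at Lebesgue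
points. -/
theorem tendsto_steklov_difference {ψ : ℝ → ℝ} (hψ : Integrable ψ) {a b : ℝ}
    (ha : HasDerivAt (fun x => ∫ t in (0 : ℝ)..x, ψ t) (ψ a) a)
    (hb : HasDerivAt (fun x => ∫ t in (0 : ℝ)..x, ψ t) (ψ b) b) :
    Tendsto (fun h : ℝ => h⁻¹ * ∫ t in a..b, (ψ (t + h) - ψ t)) (𝓝[>] 0) (𝓝 (ψ b - ψ a)) := by
  have hi : ∀ x y, IntervalIntegrable ψ volume x y := fun x y => hψ.intervalIntegrable
  have h1 := (hasDerivAt_iff_tendsto_slope_zero.mp hb).sub (hasDerivAt_iff_tendsto_slope_zero.mp ha)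
  refine (h1.mono_left (nhdsWithin_mono _ fun x hx => (ne_of_gt hx : x ≠ 0))).congr fun h => ?_
  have hc : IntervalIntegrable (fun t => ψ (t + h)) volume a b :=
    (hψ.comp_add_right h).intervalIntegrable
  rw [intervalIntegral.integral_sub hc (hi _ _), intervalIntegral.integral_comp_add_right,
    ← intervalIntegral.integral_interval_sub_left (hi 0 (b + h)) (hi 0 (a + h)),
    ← intervalIntegral.integral_interval_sub_left (hi 0 b) (hi 0 a)]
  simp only [smul_eq_mul]
  ring

variable {H : Type*} [NormedAddCommGroup H] [InnerProductSpace ℝ H]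

/-- By `‖x‖² - ‖y‖² = (x - y, x + y)`, the quotients in the two preceding limits coincide: one tends
to the difference of squared norms, the other to the integrated pairing. -/
theorem norm_sq_sub_norm_sq_eq (i : V →L[ℝ] H) {T : ℝ} {e : ℝ → V} {g : ℝ → StrongDual ℝ V}
    (he : MemLp e 2 volume) (hg : MemLp g 2 volume) {c : StrongDual ℝ V}
    (h : ∀ᵐ t, t ∈ Ioo 0 T → (innerSL ℝ (i (e t))).comp i = c + ∫ s in (0 : ℝ)..t, g s)
    {a b : ℝ} (ha : a ∈ Ioo 0 T) (hb : b ∈ Ioo 0 T) (hab : a ≤ b)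
    (hda : HasDerivAt (fun x => ∫ s in (0 : ℝ)..x, ‖i (e s)‖ ^ 2) (‖i (e a)‖ ^ 2) a)
    (hdb : HasDerivAt (fun x => ∫ s in (0 : ℝ)..x, ‖i (e s)‖ ^ 2) (‖i (e b)‖ ^ 2) b) :
    ‖i (e b)‖ ^ 2 - ‖i (e a)‖ ^ 2 = 2 * ∫ s in a..b, g s (e s) := by
  have hloc : LocallyIntegrable g := hg.locallyIntegrable (by norm_num)
  have hgi : ∀ x y, IntervalIntegrable g volume x y := fun x y =>
    (hloc.integrableOn_isCompact isCompact_uIcc).intervalIntegrable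
  have l1 := tendsto_steklov_difference
    ((i.comp_memLp' he).integrable_norm_pow (p := 2) (by simp)) hda hdb
  have l2 := tendsto_steklov_pairing hg he (Ioc a b)
  rw [← intervalIntegral.integral_of_le hab] at l2
  refine tendsto_nhds_unique l1 (l2.congr' ?_)
  -- Keeps `t + k` inside `(0, T)` for `t ≤ b`, where the primitive formula is available.
  have hsmall : ∀ᶠ k in 𝓝[>] (0 : ℝ), k < T - b :=
    nhdsWithin_le_nhds (gt_mem_nhds (by linarith [hb.2]))
  filter_upwards [hsmall, self_mem_nhdsWithin] with k hk hk0
  have hk0 : 0 < k := hk0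
  congr 1
  rw [intervalIntegral.integral_of_le hab]
  apply setIntegral_congr_ae measurableSet_Ioc
  have hk' := (measurePreserving_add_right volume k).quasiMeasurePreserving.ae h
  filter_upwards [h, hk'] with t h1 h2 ht
  have r1 := h1 ⟨lt_trans ha.1 ht.1, lt_of_le_of_lt ht.2 hb.2⟩
  have r2 := h2 ⟨by linarith [ha.1, ht.1], by linarith [ht.2]⟩
  have r3 : ∫ σ in t..(t + k), g σ
      = (innerSL ℝ (i (e (t + k)))).comp i - (innerSL ℝ (i (e t))).comp i := by
    rw [r1, r2, ← intervalIntegral.integral_interval_sub_left (hgi 0 (t + k)) (hgi 0 t)]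
    abel
  rw [r3]
  simp only [sub_apply, ContinuousLinearMap.comp_apply, innerSL_apply_apply,
    map_add, real_inner_self_eq_norm_sq, Function.comp_apply]
  rw [real_inner_comm (i (e (t + k))) (i (e t))]
  ring

theorem memLp_indicator_Ioo {X : Type*} [NormedAddCommGroup X] {T : ℝ} {p : ℝ → X}
    (hp : MemLp p 2 (volume.restrict (Ioo 0 T))) : MemLp ((Ioo 0 T).indicator p) 2 volume :=
  (memLp_indicator_iff_restrict measurableSet_Ioo).mpr hp

theorem intervalIntegral_indicator_Ioo {X : Type*} [NormedAddCommGroup X] [NormedSpace ℝ X]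
    {T t : ℝ} (ht : t ∈ Ioo 0 T) (p : ℝ → X) :
    ∫ s in (0 : ℝ)..t, (Ioo 0 T).indicator p s = ∫ s in (0 : ℝ)..t, p s := by
  rw [intervalIntegral.integral_of_le ht.1.le, intervalIntegral.integral_of_le ht.1.le]
  exact setIntegral_congr_fun measurableSet_Ioc fun s hs =>
    indicator_of_mem (s := Ioo 0 T) ⟨hs.1, lt_of_le_of_lt hs.2 ht.2⟩ p

/-- The energy identity for `e ∈ L²(0,T;V)` whose image in the dual of `V` is a primitive of
`g ∈ L²(0,T;V')`. -/
theorem exists_ae_norm_sq_eq (i : V →L[ℝ] H) {T : ℝ} (hT : 0 < T) {e : ℝ → V}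
    {g : ℝ → StrongDual ℝ V} (he : MemLp e 2 (volume.restrict (Ioo 0 T)))
    (hg : MemLp g 2 (volume.restrict (Ioo 0 T))) {c : StrongDual ℝ V}
    (h : ∀ᵐ t ∂volume.restrict (Ioo 0 T),
      (innerSL ℝ (i (e t))).comp i = c + ∫ s in (0 : ℝ)..t, g s) :
    ∃ C : ℝ, ∀ᵐ t ∂volume.restrict (Ioo 0 T),
      ‖i (e t)‖ ^ 2 = C + 2 * ∫ s in (0 : ℝ)..t, g s (e s) := by
  have hEL : MemLp ((Ioo 0 T).indicator e) 2 volume :=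
    memLp_indicator_Ioo he
  have hGL : MemLp ((Ioo 0 T).indicator g) 2 volume :=
    memLp_indicator_Ioo hg
  have hEe : ∀ t ∈ Ioo 0 T, (Ioo 0 T).indicator e t = e t := fun t ht => indicator_of_mem ht e
  have hge : ∀ t, (Ioo 0 T).indicator g t ((Ioo 0 T).indicator e t)
      = (Ioo 0 T).indicator (fun s => g s (e s)) t := by
    intro t
    by_cases ht : t ∈ Ioo 0 T <;> simp [ht]
  have hGE : Integrable ((Ioo 0 T).indicator fun s => g s (e s)) :=
    (integrable_apply_of_memLp hGL hEL).congr (Eventually.of_forall hge)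
  have hG : ∀ᵐ t, t ∈ Ioo 0 T → (innerSL ℝ (i ((Ioo 0 T).indicator e t))).comp i
      = c + ∫ s in (0 : ℝ)..t, (Ioo 0 T).indicator g s := by
    rw [ae_restrict_iff' measurableSet_Ioo] at h
    filter_upwards [h] with t ht hmem
    rw [hEe t hmem, ht hmem, intervalIntegral_indicator_Ioo hmem]
  have hD := LocallyIntegrable.ae_hasDerivAt_integral
    ((i.comp_memLp' hEL).integrable_norm_pow (p := 2) (by simp)).locallyIntegrable
  -- One Lebesgue point serves as reference time and fixes the constant `C`; every other Lebesgue
  -- point in the interval is compared with it.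
  obtain ⟨a, ha, hda⟩ : ∃ a ∈ Ioo 0 T, ∀ c, HasDerivAt
      (fun x => ∫ s in c..x, ‖i ((Ioo 0 T).indicator e s)‖ ^ 2)
      (‖i ((Ioo 0 T).indicator e a)‖ ^ 2) a := by
    have : NeBot (ae (volume.restrict (Ioo 0 T))) := by
      rw [ae_neBot]; simp [Measure.restrict_eq_zero, hT]
    obtain ⟨t, ht, ht'⟩ := ((ae_restrict_mem measurableSet_Ioo).and
      (ae_restrict_of_ae (s := Ioo 0 T) hD)).exists
    exact ⟨t, ht, ht'⟩
  refine ⟨‖i (e a)‖ ^ 2 - 2 * ∫ s in (0 : ℝ)..a, g s (e s), ?_⟩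
  rw [ae_restrict_iff' measurableSet_Ioo]
  filter_upwards [hD] with t hdt ht
  have hi : ∀ x y, IntervalIntegrable ((Ioo 0 T).indicator fun s => g s (e s)) volume x y :=
    fun x y => hGE.intervalIntegrable
  have e3 : ‖i (e t)‖ ^ 2 - ‖i (e a)‖ ^ 2
      = 2 * ∫ s in a..t, (Ioo 0 T).indicator (fun s => g s (e s)) s := by
    simp only [← hge]
    rw [← hEe t ht, ← hEe a ha]
    rcases le_total a t with hle | hle
    · exact norm_sq_sub_norm_sq_eq i hEL hGL hG ha ht hle (hda 0) (hdt 0)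
    · have := norm_sq_sub_norm_sq_eq i hEL hGL hG ht ha hle (hdt 0) (hda 0)
      rw [intervalIntegral.integral_symm]
      linarith
  rw [← intervalIntegral.integral_interval_sub_left (hi 0 t) (hi 0 a),
    intervalIntegral_indicator_Ioo ht, intervalIntegral_indicator_Ioo ha] at e3
  linarith

end Energy

/-! ### The continuous representative and the energy identity up to the endpoints. -/

section ContinuousRepresentative

open scoped Topology

variable {V : Type*} [NormedAddCommGroup V] [NormedSpace ℝ V]
variable {H : Type*} [NormedAddCommGroup H] [InnerProductSpace ℝ H]

/-- From `‖x - y‖² = ‖x‖² - ‖y‖² - 2(x - y, y)`, the two identities give `‖i e(t) - i e(σ)‖² =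
2∫_σ^t ⟨g, e - e(σ)⟩`; Young's inequality does the rest. -/
theorem norm_sub_sq_le (i : V →L[ℝ] H) {e : ℝ → V} {g : ℝ → StrongDual ℝ V}
    (he : MemLp e 2 volume) (hg : MemLp g 2 volume) {a b σ t : ℝ} (hσ : σ ∈ Icc a b)
    (ht : t ∈ Icc a b)
    (h1 : (innerSL ℝ (i (e t))).comp i - (innerSL ℝ (i (e σ))).comp i = ∫ s in σ..t, g s)
    (h2 : ‖i (e t)‖ ^ 2 - ‖i (e σ)‖ ^ 2 = 2 * ∫ s in σ..t, g s (e s)) :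
    ‖i (e t) - i (e σ)‖ ^ 2 ≤
      (∫ s in a..b, (2 * ‖g s‖ ^ 2 + ‖e s‖ ^ 2)) + (b - a) * ‖e σ‖ ^ 2 := by
  have hab : a ≤ b := hσ.1.trans hσ.2
  have hloc : LocallyIntegrable g := hg.locallyIntegrable (by norm_num)
  have hgi : IntervalIntegrable g volume σ t :=
    (hloc.integrableOn_isCompact isCompact_uIcc).intervalIntegrable
  have hge : Integrable (fun s => g s (e s)) := integrable_apply_of_memLp hg he
  have hgσ : IntervalIntegrable (fun s => g s (e σ)) volume σ t :=
    ⟨hgi.1.apply_continuousLinearMap _, hgi.2.apply_continuousLinearMap _⟩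
  have hg2 : Integrable (fun s => ‖g s‖ ^ 2) := hg.integrable_norm_pow (by simp)
  have he2 : Integrable (fun s => ‖e s‖ ^ 2) := he.integrable_norm_pow (by simp)
  have h3 := congrArg (fun L : StrongDual ℝ V => L (e σ)) h1
  simp only [sub_apply, ContinuousLinearMap.comp_apply, innerSL_apply_apply] at h3
  rw [ContinuousLinearMap.intervalIntegral_apply (𝕜 := ℝ) (φ := g) hgi,
    real_inner_self_eq_norm_sq] at h3
  have hexp : ‖i (e t) - i (e σ)‖ ^ 2 = ∫ s in σ..t, 2 * g s (e s - e σ) := by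
    simp only [map_sub]
    rw [intervalIntegral.integral_const_mul,
      intervalIntegral.integral_sub hge.intervalIntegrable hgσ, ← h3, norm_sub_sq_real]
    linarith
  have hbi : Integrable (fun s => 2 * ‖g s‖ ^ 2 + ‖e s‖ ^ 2) := (hg2.const_mul 2).add he2
  have hbi' : IntervalIntegrable (fun s => 2 * ‖g s‖ ^ 2 + ‖e s‖ ^ 2 + ‖e σ‖ ^ 2) volume a b :=
    hbi.intervalIntegrable.add intervalIntegrable_const
  have hbound : (∫ s in a..b, (2 * ‖g s‖ ^ 2 + ‖e s‖ ^ 2)) + (b - a) * ‖e σ‖ ^ 2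
      = ∫ s in a..b, (2 * ‖g s‖ ^ 2 + ‖e s‖ ^ 2 + ‖e σ‖ ^ 2) := by
    rw [intervalIntegral.integral_add hbi.intervalIntegrable intervalIntegrable_const,
      intervalIntegral.integral_const, smul_eq_mul]
  rw [hexp, hbound]
  refine (le_abs_self _).trans ?_
  have hsub : uIoc σ t ⊆ Ioc a b := fun s hs =>
    ⟨lt_of_le_of_lt (le_min hσ.1 ht.1) hs.1, hs.2.trans (max_le hσ.2 ht.2)⟩
  have hn := intervalIntegral.norm_integral_le_integral_norm_uIoc (a := σ) (b := t)
    (f := fun s => 2 * g s (e s - e σ)) (μ := volume)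
  rw [Real.norm_eq_abs] at hn
  refine hn.trans ?_
  rw [intervalIntegral.integral_of_le hab]
  have hbon : IntegrableOn (fun s => 2 * ‖g s‖ ^ 2 + ‖e s‖ ^ 2 + ‖e σ‖ ^ 2) (Ioc a b) := hbi'.1
  have hdi : IntegrableOn (fun s => 2 * g s (e s - e σ)) (uIoc σ t) := by
    simp only [map_sub]
    exact ((hge.integrableOn.sub (intervalIntegrable_iff.mp hgσ)).const_mul 2)
  refine (setIntegral_mono hdi.norm (hbon.mono_set hsub) fun s => ?_).trans
    (setIntegral_mono_set hbon (Eventually.of_forall fun s => ?_) hsub.eventuallyLE)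
  · have l1 : |g s (e s - e σ)| ≤ ‖g s‖ * (‖e s‖ + ‖e σ‖) :=
      ((g s).le_opNorm _).trans (by gcongr; exact norm_sub_le _ _)
    simp only [norm_mul, Real.norm_eq_abs, abs_two]
    nlinarith [sq_nonneg (‖g s‖ - ‖e s‖), sq_nonneg (‖g s‖ - ‖e σ‖)]
  · simp only [Pi.zero_apply]; positivity

/-- A function is at most its mean somewhere outside any given null set. This controls the otherwise
unbounded `V`-norm at the comparison time. -/
theorem exists_mul_norm_sq_le {X : Type*} [NormedAddCommGroup X] {e : ℝ → X}
    (he : MemLp e 2 volume) {P : ℝ → Prop} {p δ : ℝ}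
    (hδ : 0 < δ) (hP : ∀ᵐ t, t ∈ Ioo p (p + δ) → P t) :
    ∃ σ ∈ Ioo p (p + δ), P σ ∧ δ * ‖e σ‖ ^ 2 ≤ ∫ s in p..(p + δ), ‖e s‖ ^ 2 := by
  have he2 : Integrable (fun s => ‖e s‖ ^ 2) := he.integrable_norm_pow (by simp)
  have hP' : ∀ᵐ t ∂volume.restrict (Ioo p (p + δ)), t ∈ Ioo p (p + δ) ∧ P t := by
    rw [ae_restrict_iff' measurableSet_Ioo]
    filter_upwards [hP] with t h1 h2 using ⟨h2, h1 h2⟩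
  obtain ⟨σ, hσ, hle⟩ := exists_notMem_null_le_average (μ := volume.restrict (Ioo p (p + δ)))
    (by simp [Measure.restrict_eq_zero, hδ]) he2.integrableOn (ae_iff.mp hP')
  have hσ' : σ ∈ Ioo p (p + δ) ∧ P σ := not_not.mp hσ
  refine ⟨σ, hσ'.1, hσ'.2, ?_⟩
  rw [setAverage_eq, ← integral_Ioc_eq_integral_Ioo,
    ← intervalIntegral.integral_of_le (by linarith)] at hle
  have hv : volume.real (Ioo p (p + δ)) = δ := by simp [Measure.real, hδ.le]
  rw [hv, smul_eq_mul] at hle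
  calc δ * ‖e σ‖ ^ 2 ≤ δ * (δ⁻¹ * ∫ s in p..(p + δ), ‖e s‖ ^ 2) := by gcongr
    _ = _ := by field_simp

theorem exists_forall_norm_sub_sq_le (i : V →L[ℝ] H) {T : ℝ} {e : ℝ → V} {g : ℝ → StrongDual ℝ V}
    (he : MemLp e 2 volume) (hg : MemLp g 2 volume) {A : Set ℝ}
    (hA : ∀ᵐ t, t ∈ Ioo 0 T → t ∈ A)
    (h1 : ∀ σ ∈ A, ∀ t ∈ A,
      (innerSL ℝ (i (e t))).comp i - (innerSL ℝ (i (e σ))).comp i = ∫ s in σ..t, g s)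
    (h2 : ∀ σ ∈ A, ∀ t ∈ A,
      ‖i (e t)‖ ^ 2 - ‖i (e σ)‖ ^ 2 = 2 * ∫ s in σ..t, g s (e s))
    {r δ : ℝ} (hr : r ∈ Icc 0 T) (hδ : 0 < δ) (hδT : δ ≤ T / 2) :
    ∃ σ : ℝ, ∀ t ∈ A ∩ Icc (r - δ) (r + δ),
      ‖i (e t) - i (e σ)‖ ^ 2 ≤ 3 * ∫ s in (r - δ)..(r + δ), (‖g s‖ ^ 2 + ‖e s‖ ^ 2) := by
  have hg2 : Integrable (fun s => ‖g s‖ ^ 2) := hg.integrable_norm_pow (by simp)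
  have he2 : Integrable (fun s => ‖e s‖ ^ 2) := he.integrable_norm_pow (by simp)
  -- The comparison time needs an interval of length `δ` within both `[0, T]` and `[r - δ, r + δ]`:
  -- it is taken to the right of `r` in the first half of `[0, T]` and to the left in the second. As
  -- the large window has length `2δ`, the bound picks up `2∫‖e‖²`, whence the factor 3 in the
  -- conclusion.
  obtain ⟨p, hp0, hpT, hpr, hpr'⟩ : ∃ p, 0 ≤ p ∧ p + δ ≤ T ∧ r - δ ≤ p ∧ p ≤ r := by
    rcases le_total r (T / 2) with h | h
    · exact ⟨r, hr.1, by linarith, by linarith, le_rfl⟩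
    · exact ⟨r - δ, by linarith, by linarith [hr.2], le_rfl, by linarith⟩
  obtain ⟨σ, hσ, hσA, hle⟩ := exists_mul_norm_sq_le he (P := fun t => t ∈ A) hδ
    (hA.mono fun t h ht => h ⟨by linarith [ht.1], by linarith [ht.2]⟩) (p := p)
  refine ⟨σ, fun t ht => ?_⟩
  have hσI : σ ∈ Icc (r - δ) (r + δ) := ⟨by linarith [hσ.1], by linarith [hσ.2]⟩
  refine (norm_sub_sq_le i he hg hσI ht.2 (h1 σ hσA t ht.1) (h2 σ hσA t ht.1)).trans ?_
  have hmono : ∫ s in p..(p + δ), ‖e s‖ ^ 2 ≤ ∫ s in (r - δ)..(r + δ), ‖e s‖ ^ 2 :=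
    intervalIntegral.integral_mono_interval hpr (by linarith) (by linarith)
      (Eventually.of_forall fun s => by positivity) he2.intervalIntegrable
  have hg0 : 0 ≤ ∫ s in (r - δ)..(r + δ), ‖g s‖ ^ 2 :=
    intervalIntegral.integral_nonneg (by linarith) fun s _ => by positivity
  rw [intervalIntegral.integral_add (hg2.const_mul 2).intervalIntegrable he2.intervalIntegrable,
    intervalIntegral.integral_add hg2.intervalIntegrable he2.intervalIntegrable,
    intervalIntegral.integral_const_mul]
  linarith

/-- Near `r` all values lie close to the value at one comparison time, and the radius tends to zero
by absolute continuity of the integral. -/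
theorem cauchy_map_nhdsWithin (i : V →L[ℝ] H) {T : ℝ} (hT : 0 < T) {e : ℝ → V}
    {g : ℝ → StrongDual ℝ V}
    (he : MemLp e 2 volume) (hg : MemLp g 2 volume) {A : Set ℝ}
    (hA : ∀ᵐ t, t ∈ Ioo 0 T → t ∈ A)
    (h1 : ∀ σ ∈ A, ∀ t ∈ A,
      (innerSL ℝ (i (e t))).comp i - (innerSL ℝ (i (e σ))).comp i = ∫ s in σ..t, g s)
    (h2 : ∀ σ ∈ A, ∀ t ∈ A,
      ‖i (e t)‖ ^ 2 - ‖i (e σ)‖ ^ 2 = 2 * ∫ s in σ..t, g s (e s))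
    {r : ℝ} (hr : r ∈ Icc 0 T) (hrA : r ∈ closure A) :
    Cauchy (map (fun t => i (e t)) (𝓝[A] r)) := by
  have hN : Integrable (fun s => ‖g s‖ ^ 2 + ‖e s‖ ^ 2) :=
    (hg.integrable_norm_pow (by simp)).add (he.integrable_norm_pow (by simp))
  have : NeBot (𝓝[A] r) := mem_closure_iff_nhdsWithin_neBot.mp hrA
  rw [Metric.cauchy_iff]
  refine ⟨inferInstance, fun ε hε => ?_⟩
  have hprim : Continuous fun x => ∫ s in r..x, (‖g s‖ ^ 2 + ‖e s‖ ^ 2) :=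
    intervalIntegral.continuous_primitive (fun a b => hN.intervalIntegrable) r
  have hlim : Tendsto (fun δ => 3 * ∫ s in (r - δ)..(r + δ), (‖g s‖ ^ 2 + ‖e s‖ ^ 2))
      (𝓝[>] 0) (𝓝 0) := by
    have hc : Continuous fun δ => 3 * ((∫ s in r..(r + δ), (‖g s‖ ^ 2 + ‖e s‖ ^ 2))
        - ∫ s in r..(r - δ), (‖g s‖ ^ 2 + ‖e s‖ ^ 2)) :=
      continuous_const.mul ((hprim.comp (by fun_prop)).sub (hprim.comp (by fun_prop)))
    have h0 := (hc.tendsto 0).mono_left (nhdsWithin_le_nhds (s := Ioi 0))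
    simp only [add_zero, sub_zero, sub_self, mul_zero] at h0
    refine h0.congr fun δ => ?_
    rw [intervalIntegral.integral_interval_sub_left hN.intervalIntegrable hN.intervalIntegrable]
  have hev1 := hlim.eventually (gt_mem_nhds (show (0 : ℝ) < (ε / 2) ^ 2 by positivity))
  have hev2 : ∀ᶠ δ in 𝓝[>] (0 : ℝ), δ < T / 2 :=
    nhdsWithin_le_nhds (gt_mem_nhds (by positivity))
  obtain ⟨δ, hδ1, hδ2, hδ0⟩ := (hev1.and (hev2.and self_mem_nhdsWithin)).exists
  have hδ0 : 0 < δ := hδ0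
  obtain ⟨σ, hσ⟩ := exists_forall_norm_sub_sq_le i he hg hA h1 h2 hr hδ0 hδ2.le
  refine ⟨(fun t => i (e t)) '' (A ∩ Icc (r - δ) (r + δ)), image_mem_map ?_, ?_⟩
  · exact inter_mem self_mem_nhdsWithin
      (nhdsWithin_le_nhds (Icc_mem_nhds (by linarith) (by linarith)))
  · have hlt : ∀ t ∈ A ∩ Icc (r - δ) (r + δ), ‖i (e t) - i (e σ)‖ < ε / 2 := fun t ht =>
      lt_of_pow_lt_pow_left₀ 2 (by positivity) ((hσ t ht).trans_lt hδ1)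
    rintro _ ⟨t, ht, rfl⟩ _ ⟨t', ht', rfl⟩
    calc dist (i (e t)) (i (e t')) ≤ dist (i (e t)) (i (e σ)) + dist (i (e t')) (i (e σ)) :=
          dist_triangle_right _ _ _
      _ < ε / 2 + ε / 2 := by
          rw [dist_eq_norm, dist_eq_norm]; exact add_lt_add (hlt t ht) (hlt t' ht')
      _ = ε := by ring

/-- Existence of a continuous representative. -/
theorem exists_continuousOn_ae_eq [CompleteSpace H] (i : V →L[ℝ] H) {T : ℝ} (hT : 0 < T)
    {e : ℝ → V} {g : ℝ → StrongDual ℝ V} (he : MemLp e 2 (volume.restrict (Ioo 0 T)))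
    (hg : MemLp g 2 (volume.restrict (Ioo 0 T))) {c : StrongDual ℝ V}
    (h : ∀ᵐ t ∂volume.restrict (Ioo 0 T),
      (innerSL ℝ (i (e t))).comp i = c + ∫ s in (0 : ℝ)..t, g s) :
    ∃ w : ℝ → H, ContinuousOn w (Icc 0 T) ∧
      ∀ᵐ t ∂volume.restrict (Ioo 0 T), w t = i (e t) := by
  obtain ⟨C, hC⟩ := exists_ae_norm_sq_eq i hT he hg h
  have hEL : MemLp ((Ioo 0 T).indicator e) 2 volume := memLp_indicator_Ioo he
  have hGL : MemLp ((Ioo 0 T).indicator g) 2 volume := memLp_indicator_Ioo hg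
  have hGE := integrable_apply_of_memLp hGL hEL
  have hloc : LocallyIntegrable ((Ioo 0 T).indicator g) := hGL.locallyIntegrable (by norm_num)
  have hGi : ∀ x y, IntervalIntegrable ((Ioo 0 T).indicator g) volume x y := fun x y =>
    (hloc.integrableOn_isCompact isCompact_uIcc).intervalIntegrable
  have hEe : ∀ t ∈ Ioo 0 T, (Ioo 0 T).indicator e t = e t := fun t ht => indicator_of_mem ht e
  have hge : ∀ t, (Ioo 0 T).indicator g t ((Ioo 0 T).indicator e t)
      = (Ioo 0 T).indicator (fun s => g s (e s)) t := by
    intro t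
    by_cases ht : t ∈ Ioo 0 T <;> simp [ht]
  -- The times at which both a.e. identities hold. `A` has full measure in `(0, T)`, hence is dense
  -- in `[0, T]`, and the representative is the extension by limits along `A`.
  set A : Set ℝ := {t | t ∈ Ioo 0 T ∧ (innerSL ℝ (i (e t))).comp i = c + ∫ s in (0 : ℝ)..t, g s ∧
    ‖i (e t)‖ ^ 2 = C + 2 * ∫ s in (0 : ℝ)..t, g s (e s)} with hAdef
  have hA : ∀ᵐ t, t ∈ Ioo 0 T → t ∈ A := by
    rw [ae_restrict_iff' measurableSet_Ioo] at h hC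
    filter_upwards [h, hC] with t a1 a2 ht using ⟨ht, a1 ht, a2 ht⟩
  have h1 : ∀ σ ∈ A, ∀ t ∈ A, (innerSL ℝ (i ((Ioo 0 T).indicator e t))).comp i
      - (innerSL ℝ (i ((Ioo 0 T).indicator e σ))).comp i
      = ∫ s in σ..t, (Ioo 0 T).indicator g s := by
    intro σ hσ t ht
    rw [hEe t ht.1, hEe σ hσ.1, ht.2.1, hσ.2.1,
      ← intervalIntegral.integral_interval_sub_left (hGi 0 t) (hGi 0 σ),
      intervalIntegral_indicator_Ioo ht.1, intervalIntegral_indicator_Ioo hσ.1]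
    abel
  have h2 : ∀ σ ∈ A, ∀ t ∈ A, ‖i ((Ioo 0 T).indicator e t)‖ ^ 2
      - ‖i ((Ioo 0 T).indicator e σ)‖ ^ 2
      = 2 * ∫ s in σ..t, (Ioo 0 T).indicator g s ((Ioo 0 T).indicator e s) := by
    intro σ hσ t ht
    rw [← intervalIntegral.integral_interval_sub_left (a := 0) hGE.intervalIntegrable
      hGE.intervalIntegrable]
    simp only [hge]
    rw [hEe t ht.1, hEe σ hσ.1, ht.2.2, hσ.2.2,
      intervalIntegral_indicator_Ioo ht.1, intervalIntegral_indicator_Ioo hσ.1]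
    ring
  have hcl : Icc 0 T ⊆ closure A := by
    rw [← closure_Ioo hT.ne]
    refine closure_minimal ?_ isClosed_closure
    refine ((Measure.dense_of_ae hA).open_subset_closure_inter isOpen_Ioo).trans (closure_mono ?_)
    rintro t ⟨ht, ht'⟩
    exact ht' ht
  have hcauchy : ∀ r ∈ Icc 0 T,
      ∃ y, Tendsto (fun t => i ((Ioo 0 T).indicator e t)) (𝓝[A] r) (𝓝 y) := fun r hr =>
    have : NeBot (𝓝[A] r) := mem_closure_iff_nhdsWithin_neBot.mp (hcl hr)
    cauchy_map_iff_exists_tendsto.mp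
      (cauchy_map_nhdsWithin i hT hEL hGL hA h1 h2 hr (hcl hr))
  refine ⟨extendFrom A (fun t => i ((Ioo 0 T).indicator e t)),
    continuousOn_extendFrom hcl hcauchy, ?_⟩
  rw [ae_restrict_iff' measurableSet_Ioo]
  filter_upwards [hA] with t ht hmem
  obtain ⟨y, hy⟩ := hcauchy t (Ioo_subset_Icc_self hmem)
  rw [extendFrom_eq (hcl (Ioo_subset_Icc_self hmem)) hy, ← hEe t hmem]
  exact tendsto_nhds_unique (hy.mono_left (pure_le_nhdsWithin (ht hmem))) (tendsto_pure_nhds _ _)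

/-- Both sides of the a.e. identity now have continuous versions on `[0, T]`, so equality holds at
`0` and `T` too. -/
theorem norm_sq_sub_norm_sq_eq_of_continuousOn (i : V →L[ℝ] H) {T : ℝ} (hT : 0 < T)
    {e : ℝ → V} {g : ℝ → StrongDual ℝ V} (he : MemLp e 2 (volume.restrict (Ioo 0 T)))
    (hg : MemLp g 2 (volume.restrict (Ioo 0 T))) {c : StrongDual ℝ V}
    (h : ∀ᵐ t ∂volume.restrict (Ioo 0 T),
      (innerSL ℝ (i (e t))).comp i = c + ∫ s in (0 : ℝ)..t, g s)
    {w : ℝ → H} (hw : ContinuousOn w (Icc 0 T))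
    (hwe : ∀ᵐ t ∂volume.restrict (Ioo 0 T), w t = i (e t)) :
    ‖w T‖ ^ 2 - ‖w 0‖ ^ 2 = 2 * ∫ s in Ioo 0 T, g s (e s) := by
  obtain ⟨C, hC⟩ := exists_ae_norm_sq_eq i hT he hg h
  have heq : EqOn (fun t => ‖w t‖ ^ 2) (fun t => C + 2 * ∫ s in (0 : ℝ)..t, g s (e s))
      (Icc 0 T) := by
    refine Measure.eqOn_Icc_of_ae_eq volume hT.ne ?_ (hw.norm.pow 2)
      (continuousOn_const.add (continuousOn_const.mul
        (continuousOn_primitive_of_integrableOn (integrable_apply_of_memLp hg he))))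
    rw [← restrict_Ioo_eq_restrict_Icc]
    filter_upwards [hwe, hC] with t a1 a2
    rw [a1, a2]
  have e0 := heq (left_mem_Icc.mpr hT.le)
  have eT := heq (right_mem_Icc.mpr hT.le)
  simp only [intervalIntegral.integral_same] at e0
  simp only at eT
  rw [e0, eT, intervalIntegral.integral_of_le hT.le, integral_Ioc_eq_integral_Ioo]
  ring

end ContinuousRepresentative

/-! ### Piecewise constant and piecewise affine interpolants. -/

section TimeGrid

variable {T : ℝ} (G : TimeGrid T)

theorem TimeGrid.pt_mono {m n : ℕ} (hmn : m ≤ n) (hn : n ≤ G.N) : G.pt m ≤ G.pt n := by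
  induction n, hmn using Nat.le_induction with
  | base => exact le_rfl
  | succ k hk ih => exact (ih (by omega)).trans (G.pt_lt k (by omega)).le

theorem TimeGrid.pt_nonneg {n : ℕ} (hn : n ≤ G.N) : 0 ≤ G.pt n :=
  G.pt_zero.symm.le.trans (G.pt_mono (Nat.zero_le n) hn)

theorem TimeGrid.pt_le {n : ℕ} (hn : n ≤ G.N) : G.pt n ≤ T :=
  (G.pt_mono hn le_rfl).trans G.pt_last.le

theorem TimeGrid.step_pos {n : ℕ} (hn : n < G.N) : 0 < G.step n := sub_pos.mpr (G.pt_lt n hn)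

theorem TimeGrid.exists_mem_Ioc {t : ℝ} (ht : t ∈ Ioc 0 T) :
    ∃ k < G.N, t ∈ Ioc (G.pt k) (G.pt (k + 1)) := by
  have h : ∀ n ≤ G.N, t ≤ G.pt n → ∃ k < G.N, t ∈ Ioc (G.pt k) (G.pt (k + 1)) := by
    intro n
    induction n with
    | zero => intro _ h; rw [G.pt_zero] at h; exact absurd ht.1 (not_lt.mpr h)
    | succ m ih =>
      intro hm h
      rcases le_or_gt t (G.pt m) with h' | h'
      · exact ih (by omega) h'
      · exact ⟨m, hm, h', h⟩
  exact h G.N le_rfl (ht.2.trans G.pt_last.symm.le)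

theorem TimeGrid.sum_indicator_eq {X : Type*} [AddCommGroup X] (q : ℕ → ℝ → X) {k : ℕ}
    (hk : k < G.N) {t : ℝ} (ht : t ∈ Ioc (G.pt k) (G.pt (k + 1))) :
    ∑ n ∈ Finset.range G.N, (Ioc (G.pt n) (G.pt (n + 1))).indicator (q n) t = q k t := by
  rw [Finset.sum_eq_single k]
  · exact indicator_of_mem ht _
  · intro n hn hne
    rw [Finset.mem_range] at hn
    apply indicator_of_notMem
    intro h
    rcases lt_or_gt_of_ne hne with h' | h'
    · linarith [G.pt_mono (m := n + 1) (n := k) h' hk.le, h.2, ht.1]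
    · linarith [G.pt_mono (m := k + 1) (n := n) h' hn.le, h.1, ht.2]
  · intro h
    exact absurd (Finset.mem_range.mpr hk) h

theorem pwConst_eq {X : Type*} [AddCommGroup X] (x : ℕ → X) {k : ℕ} (hk : k < G.N) {t : ℝ}
    (ht : t ∈ Ioc (G.pt k) (G.pt (k + 1))) : pwConst G x t = x (k + 1) := by
  have h0 : ¬ t ≤ 0 := not_le.mpr ((G.pt_nonneg hk.le).trans_lt ht.1)
  rw [pwConst, if_neg h0, G.sum_indicator_eq (fun n _ => x (n + 1)) hk ht]

theorem pwAffine_eq {X : Type*} [AddCommGroup X] [Module ℝ X] (x : ℕ → X) {k : ℕ} (hk : k < G.N)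
    {t : ℝ} (ht : t ∈ Ioc (G.pt k) (G.pt (k + 1))) :
    pwAffine G x t =
      ((t - G.pt k) / G.step k) • x (k + 1) + ((G.pt (k + 1) - t) / G.step k) • x k := by
  have h0 : ¬ t ≤ 0 := not_le.mpr ((G.pt_nonneg hk.le).trans_lt ht.1)
  rw [pwAffine, if_neg h0, G.sum_indicator_eq (fun n s =>
    ((s - G.pt n) / G.step n) • x (n + 1) + ((G.pt (n + 1) - s) / G.step n) • x n) hk ht]

theorem TimeGrid.last_mem : T ∈ Ioc (G.pt (G.N - 1)) (G.pt (G.N - 1 + 1)) := by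
  have h := G.pt_lt (G.N - 1) (by have := G.one_le; omega)
  have h1 : G.N - 1 + 1 = G.N := Nat.sub_add_cancel G.one_le
  rw [h1] at h ⊢
  rw [G.pt_last] at h ⊢
  exact ⟨h, le_rfl⟩

/-- Left-continuity of the piecewise constant function is what matters here: it makes the final-time
part of the energy norm vanish on `u_τ - U_τ`. -/
theorem pwAffine_last {X : Type*} [AddCommGroup X] [Module ℝ X] (x : ℕ → X) :
    pwAffine G x T = pwConst G x T := by
  have hk : G.N - 1 < G.N := by have := G.one_le; omega
  have h1 : G.N - 1 + 1 = G.N := Nat.sub_add_cancel G.one_le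
  have hs := (G.step_pos hk).ne'
  have hstep : G.step (G.N - 1) = T - G.pt (G.N - 1) := by rw [TimeGrid.step, h1, G.pt_last]
  rw [pwAffine_eq G x hk G.last_mem, pwConst_eq G x hk G.last_mem, ← hstep, div_self hs, h1,
    G.pt_last]
  simp

theorem map_pwAffine {X Y : Type*} [AddCommGroup X] [Module ℝ X] [AddCommGroup Y] [Module ℝ Y]
    (L : X →ₗ[ℝ] Y) (x : ℕ → X) {t : ℝ} (ht : t ∈ Icc 0 T) :
    L (pwAffine G x t) = pwAffine G (fun n => L (x n)) t := by
  rcases ht.1.eq_or_lt with h | h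
  · rw [← h]; simp [pwAffine]
  · obtain ⟨k, hk, hkt⟩ := G.exists_mem_Ioc ⟨h, ht.2⟩
    rw [pwAffine_eq G _ hk hkt, pwAffine_eq G _ hk hkt]
    simp

section Normed

variable {X : Type*} [NormedAddCommGroup X]

theorem memLp_sum_indicator (q : ℕ → ℝ → X) (hq : ∀ n, Continuous (q n)) :
    MemLp (fun t => ∑ n ∈ Finset.range G.N, (Ioc (G.pt n) (G.pt (n + 1))).indicator (q n) t) 2
      (volume.restrict (Ioo 0 T)) := by
  refine memLp_finsetSum _ fun n _ => MemLp.indicator measurableSet_Ioc ?_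
  obtain ⟨C, hC⟩ := (isCompact_Icc (a := (0 : ℝ)) (b := T)).exists_bound_of_continuousOn
    (hq n).continuousOn
  refine MemLp.of_bound (hq n).aestronglyMeasurable C ?_
  filter_upwards [ae_restrict_mem measurableSet_Ioo] with t ht
  exact hC t (Ioo_subset_Icc_self ht)

theorem memLp_pwConst (x : ℕ → X) : MemLp (pwConst G x) 2 (volume.restrict (Ioo 0 T)) := by
  refine (memLp_congr_ae ?_).mpr (memLp_sum_indicator G (fun n _ => x (n + 1))
    fun n => continuous_const)
  filter_upwards [ae_restrict_mem measurableSet_Ioo] with t ht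
  rw [pwConst, if_neg (not_le.mpr ht.1)]

variable [NormedSpace ℝ X]

theorem memLp_pwAffine (x : ℕ → X) : MemLp (pwAffine G x) 2 (volume.restrict (Ioo 0 T)) := by
  refine (memLp_congr_ae ?_).mpr (memLp_sum_indicator G (fun n s =>
    ((s - G.pt n) / G.step n) • x (n + 1) + ((G.pt (n + 1) - s) / G.step n) • x n)
    fun n => by fun_prop)
  filter_upwards [ae_restrict_mem measurableSet_Ioo] with t ht
  rw [pwAffine, if_neg (not_le.mpr ht.1)]

/-- The difference quotients `(x_n - x_{n-1}) / τ_n`. -/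
noncomputable def diffQuot (x : ℕ → X) (n : ℕ) : X := (G.step (n - 1))⁻¹ • (x n - x (n - 1))

theorem integral_pwConst_diffQuot [CompleteSpace X] (x : ℕ → X) {k : ℕ} (hk : k < G.N) {t : ℝ}
    (ht : t ∈ Icc (G.pt k) (G.pt (k + 1))) :
    ∫ s in (G.pt k)..t, pwConst G (diffQuot G x) s
      = ((t - G.pt k) / G.step k) • (x (k + 1) - x k) := by
  have : ∫ s in (G.pt k)..t, pwConst G (diffQuot G x) s
      = ∫ s in (G.pt k)..t, diffQuot G x (k + 1) := by
    rw [intervalIntegral.integral_of_le ht.1, intervalIntegral.integral_of_le ht.1]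
    exact setIntegral_congr_fun measurableSet_Ioc fun s hs =>
      pwConst_eq G _ hk ⟨hs.1, hs.2.trans ht.2⟩
  rw [this, intervalIntegral.integral_const, diffQuot, Nat.add_sub_cancel, smul_smul, div_eq_mul_inv]

/-- The piecewise affine interpolant is the primitive of the difference quotients. -/
theorem pwAffine_eq_integral [CompleteSpace X] (x : ℕ → X) {t : ℝ} (ht : t ∈ Icc 0 T) :
    pwAffine G x t = x 0 + ∫ s in (0 : ℝ)..t, pwConst G (diffQuot G x) s := by
  have hint : IntegrableOn (pwConst G (diffQuot G x)) (Ioc 0 T) := by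
    rw [integrableOn_Ioc_iff_integrableOn_Ioo (by simp)]
    exact (memLp_pwConst G _).integrable (by norm_num)
  have hii : ∀ a b, 0 ≤ a → a ≤ b → b ≤ T →
      IntervalIntegrable (pwConst G (diffQuot G x)) volume a b := fun a b h0 h1 h2 =>
    (intervalIntegrable_iff_integrableOn_Ioc_of_le h1).mpr
      (hint.mono_set (Ioc_subset_Ioc h0 h2))
  -- At the nodes the integral telescopes; a general time adds one partial step.
  have hnode : ∀ k ≤ G.N, x 0 + ∫ s in (0 : ℝ)..(G.pt k), pwConst G (diffQuot G x) s = x k := by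
    intro k
    induction k with
    | zero => intro _; simp [G.pt_zero]
    | succ m ih =>
      intro hm
      have hlt := G.pt_lt m hm
      rw [← intervalIntegral.integral_add_adjacent_intervals
        (hii 0 (G.pt m) le_rfl (G.pt_nonneg (by omega)) (G.pt_le (by omega)))
        (hii (G.pt m) (G.pt (m + 1)) (G.pt_nonneg (by omega)) hlt.le (G.pt_le hm)), ← add_assoc,
        ih (by omega), integral_pwConst_diffQuot G x hm (right_mem_Icc.mpr hlt.le)]
      rw [← TimeGrid.step, div_self (G.step_pos hm).ne', one_smul]
      abel
  rcases ht.1.eq_or_lt with h | h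
  · rw [← h]; simp [pwAffine]
  · obtain ⟨k, hk, hkt⟩ := G.exists_mem_Ioc ⟨h, ht.2⟩
    have hk0 := G.pt_nonneg hk.le
    rw [← intervalIntegral.integral_add_adjacent_intervals
      (hii 0 (G.pt k) le_rfl hk0 (G.pt_le hk.le))
      (hii (G.pt k) t hk0 hkt.1.le ht.2), ← add_assoc, hnode k hk.le,
      integral_pwConst_diffQuot G x hk (Ioc_subset_Icc_self hkt), pwAffine_eq G x hk hkt]
    have hs := (G.step_pos hk).ne'
    have hsum : (G.pt (k + 1) - t) / G.step k = 1 - (t - G.pt k) / G.step k := by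
      rw [eq_sub_iff_add_eq, ← add_div, div_eq_one_iff_eq hs, TimeGrid.step]; ring
    rw [hsum, sub_smul, smul_sub, one_smul]
    abel

theorem continuousOn_pwAffine [CompleteSpace X] (x : ℕ → X) :
    ContinuousOn (pwAffine G x) (Icc 0 T) :=
  (continuousOn_const.add (continuousOn_primitive_of_integrableOn
    ((memLp_pwConst G (diffQuot G x)).integrable (by norm_num)))).congr
    fun _ ht => pwAffine_eq_integral G x ht

end Normed

end TimeGrid

/-! ### The error identity and the hypercircle in an abstract setting. -/

section GelfandTriple

variable {V : Type*} [NormedAddCommGroup V] [NormedSpace ℝ V]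
variable {H : Type*} [NormedAddCommGroup H] [InnerProductSpace ℝ H]
variable {K : Type*} [NormedAddCommGroup K] [InnerProductSpace ℝ K]
variable {T : ℝ}

/-- The embedding `V → H → V'` induced by `i : V → H`. -/
noncomputable def dualEmbed (i : V →L[ℝ] H) : V →L[ℝ] StrongDual ℝ V :=
  LinearMap.mkContinuous
    { toFun := fun v => (innerSL ℝ (i v)).comp i
      map_add' := fun v w => by ext z; simp
      map_smul' := fun c v => by ext z; simp }
    (‖i‖ * ‖i‖) fun v => by
      refine ((innerSL ℝ (i v)).opNorm_comp_le i).trans ?_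
      rw [innerSL_apply_norm]
      nlinarith [i.le_opNorm v, norm_nonneg i]

theorem dualEmbed_apply (i : V →L[ℝ] H) (v : V) :
    dualEmbed i v = (innerSL ℝ (i v)).comp i := rfl

theorem dualEmbed_apply_apply (i : V →L[ℝ] H) (v w : V) :
    dualEmbed i v w = inner ℝ (i v) (i w) := rfl

theorem exists_dualEmbed_eq_primitive (i : V →L[ℝ] H) (hT : 0 < T) {u : ℝ → V}
    {du : ℝ → StrongDual ℝ V} (hu : MemBochner T u) (hdu : MemBochner T du)
    (h : HasWeakTimeDeriv T (fun t => (innerSL ℝ (i (u t))).comp i) du) :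
    ∃ c : StrongDual ℝ V, ∀ᵐ t ∂volume.restrict (Ioo 0 T),
      (innerSL ℝ (i (u t))).comp i = c + ∫ s in (0 : ℝ)..t, du s :=
  h.exists_ae_eq_primitive hT
    (((dualEmbed i).comp_memLp' hu).integrable (by norm_num)) (hdu.integrable (by norm_num))

theorem exists_continuousOn_of_hasWeakTimeDeriv [CompleteSpace H] (i : V →L[ℝ] H) (hT : 0 < T)
    {u : ℝ → V} {du : ℝ → StrongDual ℝ V} (hu : MemBochner T u) (hdu : MemBochner T du)
    (h : HasWeakTimeDeriv T (fun t => (innerSL ℝ (i (u t))).comp i) du) :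
    ∃ w : ℝ → H, ContinuousOn w (Icc 0 T) ∧ ∀ᵐ t ∂volume.restrict (Ioo 0 T), w t = i (u t) := by
  obtain ⟨c, hc⟩ := exists_dualEmbed_eq_primitive i hT hu hdu h
  exact exists_continuousOn_ae_eq i hT hu hdu hc

/-- The energy identity for the difference of a function with weak derivative in the dual and a
piecewise affine function. -/
theorem norm_sq_sub_norm_sq_pwAffine [CompleteSpace H] (i : V →L[ℝ] H) (hT : 0 < T) {u : ℝ → V}
    {du : ℝ → StrongDual ℝ V} (hu : MemBochner T u) (hdu : MemBochner T du)
    (h : HasWeakTimeDeriv T (fun t => (innerSL ℝ (i (u t))).comp i) du) {w : ℝ → H}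
    (hwc : ContinuousOn w (Icc 0 T)) (hwu : ∀ᵐ t ∂volume.restrict (Ioo 0 T), w t = i (u t))
    (G : TimeGrid T) (x : ℕ → V) :
    ‖w T - i (pwAffine G x T)‖ ^ 2 - ‖w 0 - i (x 0)‖ ^ 2
      = 2 * ∫ t in Ioo 0 T, (du t - pwConst G (diffQuot G fun n => dualEmbed i (x n)) t)
        (u t - pwAffine G x t) := by
  obtain ⟨c, hc⟩ := exists_dualEmbed_eq_primitive i hT hu hdu h
  have hi : ∀ t ∈ Icc 0 T, i (pwAffine G x t) = pwAffine G (fun n => i (x n)) t := fun t ht =>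
    map_pwAffine G (i : V →ₗ[ℝ] H) x ht
  have hj : ∀ t ∈ Icc 0 T, dualEmbed i (pwAffine G x t)
      = pwAffine G (fun n => dualEmbed i (x n)) t := fun t ht =>
    map_pwAffine G (dualEmbed i : V →ₗ[ℝ] StrongDual ℝ V) x ht
  set D := pwConst G (diffQuot G fun n => dualEmbed i (x n)) with hD
  have hDL : MemLp D 2 (volume.restrict (Ioo 0 T)) := memLp_pwConst G _
  have hint : ∀ t ∈ Ioo 0 T, ∀ g : ℝ → StrongDual ℝ V, MemLp g 2 (volume.restrict (Ioo 0 T)) →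
      IntervalIntegrable g volume 0 t := fun t ht g hg => by
    rw [intervalIntegrable_iff_integrableOn_Ioc_of_le ht.1.le]
    exact IntegrableOn.mono_set (t := Ioo 0 T) (hg.integrable (by norm_num))
      fun s hs => ⟨hs.1, lt_of_le_of_lt hs.2 ht.2⟩
  -- In `V'` both `u` and the affine interpolant are primitives, hence so is their difference.
  have hprim : ∀ᵐ t ∂volume.restrict (Ioo 0 T),
      (innerSL ℝ (i ((u - pwAffine G x) t))).comp i
        = (c - dualEmbed i (x 0)) + ∫ s in (0 : ℝ)..t, (du - D) s := by
    filter_upwards [hc, ae_restrict_mem measurableSet_Ioo] with t h1 ht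
    rw [← dualEmbed_apply] at h1 ⊢
    rw [Pi.sub_apply, map_sub, h1, hj t (Ioo_subset_Icc_self ht),
      pwAffine_eq_integral G _ (Ioo_subset_Icc_self ht)]
    simp only [Pi.sub_apply]
    rw [intervalIntegral.integral_sub (hint t ht du hdu) (hint t ht D hDL)]
    abel
  have hwe : ∀ᵐ t ∂volume.restrict (Ioo 0 T), w t - pwAffine G (fun n => i (x n)) t
      = i ((u - pwAffine G x) t) := by
    filter_upwards [hwu, ae_restrict_mem measurableSet_Ioo] with t h1 ht
    rw [h1, Pi.sub_apply, map_sub, hi t (Ioo_subset_Icc_self ht)]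
  have key := norm_sq_sub_norm_sq_eq_of_continuousOn i hT
    (hu.sub (memLp_pwAffine G x)) (hdu.sub hDL) hprim
    (hwc.sub (continuousOn_pwAffine G fun n => i (x n))) hwe
  have h0 : pwAffine G (fun n => i (x n)) 0 = i (x 0) := by simp [pwAffine]
  rw [hi T (right_mem_Icc.mpr hT.le), ← h0]
  exact key

/-- The error equation of the implicit Euler scheme tested with the error, in polarized form. -/
theorem two_mul_residual_apply (i : V →L[ℝ] H) (A : V →L[ℝ] K) {G : TimeGrid T}
    {F : ℕ → StrongDual ℝ V} {x : ℕ → V}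
    (hx : ∀ n < G.N, ∀ v : V, inner ℝ ((G.step n)⁻¹ • (i (x (n + 1)) - i (x n))) (i v)
      + inner ℝ (A (x (n + 1))) (A v) = F (n + 1) v)
    {t : ℝ} (ht : t ∈ Ioo 0 T) {ut : V} {dut : StrongDual ℝ V}
    (heq : ∀ v : V, dut v + inner ℝ (A ut) (A v) = pwConst G F t v) :
    2 * (dut - pwConst G (diffQuot G fun n => dualEmbed i (x n)) t) (ut - pwAffine G x t) =
      ‖A ((pwConst G x - pwAffine G x) t)‖ ^ 2 - ‖A (ut - pwConst G x t)‖ ^ 2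
        - ‖A (ut - pwAffine G x t)‖ ^ 2 := by
  obtain ⟨k, hk, hkt⟩ := G.exists_mem_Ioc ⟨ht.1, ht.2.le⟩
  rw [Pi.sub_apply, pwConst_eq G _ hk hkt, pwConst_eq G x hk hkt]
  set v := ut - pwAffine G x t with hv
  have h1 := heq v
  rw [pwConst_eq G F hk hkt, ← hx k hk v] at h1
  have h2 : diffQuot G (fun n => dualEmbed i (x n)) (k + 1) v
      = inner ℝ ((G.step k)⁻¹ • (i (x (k + 1)) - i (x k))) (i v) := by
    simp only [diffQuot, Nat.add_sub_cancel]
    rw [smul_apply, sub_apply, dualEmbed_apply_apply, dualEmbed_apply_apply,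
      real_inner_smul_left, inner_sub_left, smul_eq_mul]
  -- Writing the jump as a difference of the two errors makes its squared norm produce the mixed
  -- term appearing in the tested error equation.
  have h3 : x (k + 1) - pwAffine G x t = v - (ut - x (k + 1)) := by rw [hv]; abel
  have h4 : inner ℝ (A v) (A (ut - x (k + 1)))
      = inner ℝ (A ut) (A v) - inner ℝ (A (x (k + 1))) (A v) := by
    rw [real_inner_comm, map_sub, inner_sub_left]
  rw [sub_apply, h2, h3, map_sub A v, norm_sub_sq_real, h4]
  linarith

theorem integrableOn_norm_sq (A : V →L[ℝ] K) {v : ℝ → V} (hv : MemBochner T v) :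
    IntegrableOn (fun t => ‖A (v t)‖ ^ 2) (Ioo 0 T) :=
  (A.comp_memLp' hv).integrable_norm_pow (by simp)

/-- The energy norm of a function with prescribed final value. -/
noncomputable def energyNorm (A : V →L[ℝ] K) (T : ℝ) (p : (ℝ → V) × H) : ℝ :=
  √(1 / 2 * ‖p.2‖ ^ 2 + ∫ t in Ioo 0 T, ‖A (p.1 t)‖ ^ 2)

theorem energyNorm_nonneg {H : Type*} [NormedAddCommGroup H] (A : V →L[ℝ] K)
    (p : (ℝ → V) × H) : 0 ≤ energyNorm A T p :=
  Real.sqrt_nonneg _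

theorem energyNorm_sq {H : Type*} [NormedAddCommGroup H] (A : V →L[ℝ] K) (p : (ℝ → V) × H) :
    energyNorm A T p ^ 2 = 1 / 2 * ‖p.2‖ ^ 2 + ∫ t in Ioo 0 T, ‖A (p.1 t)‖ ^ 2 :=
  Real.sq_sqrt (by positivity)

theorem energyNorm_smul (A : V →L[ℝ] K) (c : ℝ) (p : (ℝ → V) × H) :
    energyNorm A T (c • p) = |c| * energyNorm A T p := by
  rw [← sq_eq_sq₀ (energyNorm_nonneg A _) (mul_nonneg (abs_nonneg c) (energyNorm_nonneg A _)),
    mul_pow, energyNorm_sq, energyNorm_sq]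
  simp only [Prod.smul_fst, Prod.smul_snd, Pi.smul_apply, map_smul, norm_smul, mul_pow,
    Real.norm_eq_abs, sq_abs]
  rw [integral_const_mul]
  ring

theorem energyNorm_sub_comm (A : V →L[ℝ] K) (p q : (ℝ → V) × H) :
    energyNorm A T (p - q) = energyNorm A T (q - p) := by
  rw [← neg_sub, ← neg_one_smul ℝ, energyNorm_smul]
  simp

/-- Square integrability is needed because the Bochner integral of a non-integrable function is zero
by convention, which could break additivity. -/
theorem energyNorm_parallelogram (A : V →L[ℝ] K) {p q : (ℝ → V) × H} (hp : MemBochner T p.1)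
    (hq : MemBochner T q.1) :
    energyNorm A T (p + q) ^ 2 + energyNorm A T (p - q) ^ 2
      = 2 * (energyNorm A T p ^ 2 + energyNorm A T q ^ 2) := by
  have hi : (∫ t in Ioo 0 T, ‖A ((p + q).1 t)‖ ^ 2) + ∫ t in Ioo 0 T, ‖A ((p - q).1 t)‖ ^ 2
      = 2 * ((∫ t in Ioo 0 T, ‖A (p.1 t)‖ ^ 2) + ∫ t in Ioo 0 T, ‖A (q.1 t)‖ ^ 2) := by
    rw [← integral_add (integrableOn_norm_sq A hp) (integrableOn_norm_sq A hq),
      ← integral_const_mul, ← integral_add (integrableOn_norm_sq A (v := (p + q).1) (hp.add hq))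
        (integrableOn_norm_sq A (v := (p - q).1) (hp.sub hq))]
    congr 1
    ext t
    have := parallelogram_law_with_norm ℝ (A (p.1 t)) (A (q.1 t))
    simp only [Prod.fst_add, Prod.fst_sub, Pi.add_apply, Pi.sub_apply, map_add, map_sub]
    linarith
  have hn := parallelogram_law_with_norm ℝ p.2 q.2
  simp only [energyNorm_sq, Prod.snd_add, Prod.snd_sub]
  linarith

/-- If the squared distances of `p` from `q` and `r` add up to the squared distance of `q` from
`r`, then all three lie on the hypercircle about the midpoint of `q` and `r`. -/
theorem energyNorm_hypercircle (A : V →L[ℝ] K) {p q r : (ℝ → V) × H} (hpq : MemBochner T (p - q).1)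
    (hpr : MemBochner T (p - r).1)
    (h : energyNorm A T (p - q) ^ 2 + energyNorm A T (p - r) ^ 2 = energyNorm A T (q - r) ^ 2) :
    energyNorm A T (p - (1 / 2 : ℝ) • (q + r)) = 1 / 2 * energyNorm A T (q - r) ∧
    energyNorm A T (q - (1 / 2 : ℝ) • (q + r)) = 1 / 2 * energyNorm A T (q - r) ∧
    energyNorm A T (r - (1 / 2 : ℝ) • (q + r)) = 1 / 2 * energyNorm A T (q - r) := by
  have hpar := energyNorm_parallelogram A hpq hpr
  have hdiff : (p - q) - (p - r) = r - q := by abel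
  rw [hdiff, energyNorm_sub_comm, h] at hpar
  -- By the Pythagorean hypothesis, the parallelogram with sides `p - q` and `p - r` has diagonals
  -- of equal length: it is a rectangle.
  have hsum : energyNorm A T ((p - q) + (p - r)) = energyNorm A T (q - r) :=
    (sq_eq_sq₀ (energyNorm_nonneg A _) (energyNorm_nonneg A _)).mp (by linarith)
  have e1 : p - (1 / 2 : ℝ) • (q + r) = (1 / 2 : ℝ) • ((p - q) + (p - r)) := by module
  have e2 : q - (1 / 2 : ℝ) • (q + r) = (1 / 2 : ℝ) • (q - r) := by module
  have e3 : r - (1 / 2 : ℝ) • (q + r) = (1 / 2 : ℝ) • (r - q) := by module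
  have habs : |(1 / 2 : ℝ)| = 1 / 2 := abs_of_pos (by norm_num)
  refine ⟨?_, ?_, ?_⟩
  · rw [e1, energyNorm_smul, hsum, habs]
  · rw [e2, energyNorm_smul, habs]
  · rw [e3, energyNorm_smul, habs, energyNorm_sub_comm]

theorem energyNorm_pwConst_sub_pwAffine (i : V →L[ℝ] H) (A : V →L[ℝ] K) (G : TimeGrid T)
    (x : ℕ → V) :
    energyNorm A T ((pwConst G x, i (pwConst G x T)) - (pwAffine G x, i (pwAffine G x T)))
      = √(∫ t in Ioo 0 T, ‖A ((pwConst G x - pwAffine G x) t)‖ ^ 2) := by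
  simp [energyNorm, pwAffine_last]

/-- The Pythagorean identity for the errors of the piecewise constant and of the piecewise affine
interpolant of the implicit Euler approximations. -/
theorem energyNorm_sq_add_energyNorm_sq [CompleteSpace H] (i : V →L[ℝ] H) (A : V →L[ℝ] K)
    (hT : 0 < T) {f : ℝ → StrongDual ℝ V} {u : ℝ → V} {du : ℝ → StrongDual ℝ V}
    (hu : MemBochner T u) (hdu : MemBochner T du)
    (h : HasWeakTimeDeriv T (fun t => (innerSL ℝ (i (u t))).comp i) du)
    (heq : ∀ᵐ t ∂volume.restrict (Ioo 0 T), ∀ v : V,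
      du t v + inner ℝ (A (u t)) (A v) = f t v)
    {w : ℝ → H} (hwc : ContinuousOn w (Icc 0 T))
    (hwu : ∀ᵐ t ∂volume.restrict (Ioo 0 T), w t = i (u t)) (G : TimeGrid T)
    {F : ℕ → StrongDual ℝ V} {x : ℕ → V} (hw0 : w 0 = i (x 0))
    (hx : ∀ n < G.N, ∀ v : V, inner ℝ ((G.step n)⁻¹ • (i (x (n + 1)) - i (x n))) (i v)
      + inner ℝ (A (x (n + 1))) (A v) = F (n + 1) v)
    (hosc : f =ᵐ[volume.restrict (Ioo 0 T)] pwConst G F) :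
    energyNorm A T ((u, w T) - (pwConst G x, i (pwConst G x T))) ^ 2
      + energyNorm A T ((u, w T) - (pwAffine G x, i (pwAffine G x T))) ^ 2
      = energyNorm A T ((pwConst G x, i (pwConst G x T)) - (pwAffine G x, i (pwAffine G x T))) ^ 2
      := by
  have key := norm_sq_sub_norm_sq_pwAffine i hT hu hdu h hwc hwu G x
  have hi1 := integrableOn_norm_sq A (v := pwConst G x - pwAffine G x)
    ((memLp_pwConst G x).sub (memLp_pwAffine G x))
  have hi2 := integrableOn_norm_sq A (v := u - pwConst G x) (hu.sub (memLp_pwConst G x))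
  have hi3 := integrableOn_norm_sq A (v := u - pwAffine G x) (hu.sub (memLp_pwAffine G x))
  have hres : 2 * ∫ t in Ioo 0 T, (du t - pwConst G (diffQuot G fun n => dualEmbed i (x n)) t)
        (u t - pwAffine G x t)
      = (∫ t in Ioo 0 T, ‖A ((pwConst G x - pwAffine G x) t)‖ ^ 2)
        - (∫ t in Ioo 0 T, ‖A ((u - pwConst G x) t)‖ ^ 2)
        - ∫ t in Ioo 0 T, ‖A ((u - pwAffine G x) t)‖ ^ 2 := by
    rw [← integral_const_mul, ← integral_sub hi1 hi2]
    refine Eq.trans ?_ (integral_sub (hi1.sub hi2) hi3)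
    apply integral_congr_ae
    filter_upwards [heq, hosc, ae_restrict_mem measurableSet_Ioo] with t h1 h2 ht
    exact two_mul_residual_apply i A hx ht fun v => by rw [h1 v, h2]
  -- The initial error vanishes. At `T` the two interpolants agree, so the weights `1/2` in the two
  -- energy norms add up to the full `‖e(T)‖²`.
  rw [hw0, sub_self, norm_zero, hres] at key
  simp only [energyNorm_sq, Prod.fst_sub, Prod.snd_sub, ← pwAffine_last, sub_self, norm_zero]
  linarith

end GelfandTriple

/-! ### Specialization to `H¹₀(Ω)`, `L²(Ω)` and the weak gradient. -/

section HeatEquation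

variable {d : ℕ} {Ω : Set (Space d)} {T : ℝ}

/-- Continuous functions that agree a.e. on `(0, T)` agree on `[0, T]`, so the choice of
representative is immaterial. -/
theorem timeValue_eq (hT : 0 < T) {u : ℝ → H10 Ω} {w : ℝ → L2 Ω} (hw : IsContRep T u w) {s : ℝ}
    (hs : s ∈ Icc 0 T) : timeValue T u s = w s := by
  have hex : ∃ w, IsContRep T u w := ⟨w, hw⟩
  have hc := Classical.choose_spec hex
  rw [timeValue, dif_pos hex]
  refine Measure.eqOn_Icc_of_ae_eq volume hT.ne ?_ hc.1 hw.1 hs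
  rw [← restrict_Ioo_eq_restrict_Icc]
  filter_upwards [hc.2, hw.2] with t h1 h2
  rw [h1, h2]

/-- Every `u ∈ Y` has a representative in `C([0,T];L²(Ω))`. -/
theorem HasYDeriv.exists_isContRep (hT : 0 < T) {u : ℝ → H10 Ω} {du : ℝ → HNeg Ω}
    (h : HasYDeriv T u du) : ∃ w, IsContRep T u w :=
  @exists_continuousOn_of_hasWeakTimeDeriv (H10 Ω) inferInstance inferInstance (L2 Ω) inferInstance
    inferInstance T inferInstance (toL2 Ω) hT u du h.memX h.memDeriv h.weakDeriv

theorem normE_hypercircle {p q r : (ℝ → H10 Ω) × L2 Ω} (hpq : MemBochner T (p - q).1)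
    (hpr : MemBochner T (p - r).1)
    (h : normE T (p - q) ^ 2 + normE T (p - r) ^ 2 = normE T (q - r) ^ 2) :
    normE T (p - (1 / 2 : ℝ) • (q + r)) = 1 / 2 * normE T (q - r) ∧
    normE T (q - (1 / 2 : ℝ) • (q + r)) = 1 / 2 * normE T (q - r) ∧
    normE T (r - (1 / 2 : ℝ) • (q + r)) = 1 / 2 * normE T (q - r) :=
  @energyNorm_hypercircle (H10 Ω) inferInstance inferInstance (L2 Ω) inferInstance inferInstance
    (L2Vec Ω) inferInstance inferInstance T (grad Ω) p q r hpq hpr h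

theorem MemBochner.sub {V : Type*} [NormedAddCommGroup V] {v w : ℝ → V} (hv : MemBochner T v)
    (hw : MemBochner T w) : MemBochner T (v - w) :=
  MemLp.sub hv hw

theorem memBochner_pwConst (G : TimeGrid T) (un : ℕ → H10 Ω) : MemBochner T (pwConst G un) :=
  @memLp_pwConst T G (H10 Ω) inferInstance un

theorem memBochner_pwAffine (G : TimeGrid T) (un : ℕ → H10 Ω) : MemBochner T (pwAffine G un) :=
  @memLp_pwAffine T G (H10 Ω) inferInstance inferInstance un

theorem normE_pwConst_sub_pwAffine (G : TimeGrid T) (un : ℕ → H10 Ω) :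
    normE T (withFinal T (pwConst G un) - withFinal T (pwAffine G un)) = etaJ G un :=
  @energyNorm_pwConst_sub_pwAffine (H10 Ω) inferInstance inferInstance (L2 Ω) inferInstance
    inferInstance (L2Vec Ω) inferInstance inferInstance T (toL2 Ω) (grad Ω) G un

theorem normE_sq_add_normE_sq (hT : 0 < T) {f : ℝ → HNeg Ω} {u₀ : H10 Ω} {u : ℝ → H10 Ω}
    (hu : IsWeakSolution T f (toL2 Ω u₀) u) {G : TimeGrid T} {F : ℕ → HNeg Ω} {un : ℕ → H10 Ω}
    (hun : IsImplicitEuler G F u₀ un) (hosc : f =ᵐ[volume.restrict (Ioo 0 T)] pwConst G F) :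
    normE T (withFinalY T u - withFinal T (pwConst G un)) ^ 2
      + normE T (withFinalY T u - withFinal T (pwAffine G un)) ^ 2
      = normE T (withFinal T (pwConst G un) - withFinal T (pwAffine G un)) ^ 2 := by
  obtain ⟨du, hdu, heq⟩ := hu.equation
  obtain ⟨w, hw⟩ := hdu.exists_isContRep hT
  have hwT := timeValue_eq hT hw (right_mem_Icc.mpr hT.le)
  -- The initial condition concerns the chosen representative; uniqueness transfers it to `w`.
  have hw0 : w 0 = toL2 Ω (un 0) := by
    rw [← timeValue_eq hT hw (left_mem_Icc.mpr hT.le), hu.initial, hun.1]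
  rw [withFinalY, hwT]
  exact @energyNorm_sq_add_energyNorm_sq (H10 Ω) inferInstance inferInstance (L2 Ω) inferInstance
    inferInstance (L2Vec Ω) inferInstance inferInstance T inferInstance (toL2 Ω) (grad Ω) hT f u du
    hdu.memX hdu.memDeriv hdu.weakDeriv heq w hw.1 hw.2 G F un hw0 hun.2 hosc

end HeatEquation

end Heat

theorem mainTheorem3 {d : ℕ} (hd : 1 ≤ d) (Ω : Set (Heat.Space d)) (hΩ : IsOpen Ω)
    (hΩb : Bornology.IsBounded Ω) {T : ℝ} (hT : 0 < T)
    (f : ℝ → Heat.HNeg Ω) (hf : Heat.MemBochner T f) (u₀ : Heat.H10 Ω)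
    (u : ℝ → Heat.H10 Ω) (hu : Heat.IsWeakSolution T f (Heat.toL2 Ω u₀) u)
    (G : Heat.TimeGrid T) (F : ℕ → Heat.HNeg Ω) (un : ℕ → Heat.H10 Ω)
    (hun : Heat.IsImplicitEuler G F u₀ un)
    (hosc : f =ᵐ[volume.restrict (Ioo 0 T)] Heat.pwConst G F)
    (bu uτ Uτ ubar : (ℝ → Heat.H10 Ω) × Heat.L2 Ω)
    (hbu : bu = Heat.withFinalY T u)
    (huτ : uτ = Heat.withFinal T (Heat.pwConst G un))
    (hUτ : Uτ = Heat.withFinal T (Heat.pwAffine G un))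
    (hubar : ubar = (1 / 2 : ℝ) • (uτ + Uτ)) :
    (Heat.normE T (bu - uτ) ^ 2 + Heat.normE T (bu - Uτ) ^ 2 = Heat.normE T (uτ - Uτ) ^ 2 ∧
      Heat.normE T (uτ - Uτ) ^ 2 = Heat.etaJ G un ^ 2) ∧
    (Heat.normE T (bu - ubar) = 1 / 2 * Heat.normE T (uτ - Uτ) ∧
      1 / 2 * Heat.normE T (uτ - Uτ) = 1 / 2 * Heat.etaJ G un) ∧
    (Heat.normE T (uτ - ubar) = 1 / 2 * Heat.etaJ G un ∧
      Heat.normE T (Uτ - ubar) = 1 / 2 * Heat.etaJ G un) := by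
  have hpyth : Heat.normE T (bu - uτ) ^ 2 + Heat.normE T (bu - Uτ) ^ 2
      = Heat.normE T (uτ - Uτ) ^ 2 := by
    rw [hbu, huτ, hUτ]
    exact Heat.normE_sq_add_normE_sq hT hu hun hosc
  have heta : Heat.normE T (uτ - Uτ) = Heat.etaJ G un := by
    rw [huτ, hUτ]
    exact Heat.normE_pwConst_sub_pwAffine G un
  obtain ⟨du, hdu, -⟩ := hu.equation
  have hm1 : Heat.MemBochner T (bu - uτ).1 := by
    rw [hbu, huτ]
    exact Heat.MemBochner.sub hdu.memX (Heat.memBochner_pwConst G un)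
  have hm2 : Heat.MemBochner T (bu - Uτ).1 := by
    rw [hbu, hUτ]
    exact Heat.MemBochner.sub hdu.memX (Heat.memBochner_pwAffine G un)
  obtain ⟨h1, h2, h3⟩ := Heat.normE_hypercircle hm1 hm2 hpyth
  rw [hubar]
  exact ⟨⟨hpyth, by rw [heta]⟩, ⟨h1, by rw [heta]⟩, by rw [← heta]; exact h2,
    by rw [← heta]; exact h3⟩
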